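/- **Theorem (stability of the fully discrete scheme).** *Mesh.* Let $\Omega_B,\Omega_D\subset\mathbb R^2$ be polygonal regions partitioned conformingly into triangles and quadrilaterals (primal elements, each contained in one region), and let $\mathcal T_h$ be the conforming triangulation of $\Omega=\Omega_B\cup\Omega_D$ obtained by joining an interior point of every primal element to its vertices (all subtriangles being non-degenerate). Let $\mathcal F_{pr}$ be the set of primal edges, $\mathcal F_{pr}^0$ those not on $\partial\Omega$, $\mathcal F_{pr,i}^0$ those interior to $\Omega_i$, $\mathcal F_{dl}$ the new (dual) edges, $\mathcal F_{dl,B}$ those in $\Omega_B$, $\Gamma=\partial\Omega_B\cap\partial\Omega_D$ the interface, $\Gamma_i=\partial\Omega_i\setminus\Gamma$, and $\mathcal F_{pr,B}$ the primal edges of $\Omega_B$ not on $\Gamma$. Each edge has a fixed unit normal $n$ (outward on $\partial\Omega$; $n_i$ is outward from $\Omega_i$) and tangent $t$; $[v]=v_1-v_2$ and $\{v\}=\frac{v_1+v_2}2$ for $n$ pointing from side 1 to side 2, and $[v]=v$ on $\partial\Omega$. Let $k\ge1$; $(\cdot,\cdot)_S$ is the $L^2(S)$ product, on $\Omega$ if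 no $S$ is given; $\nabla_h,\operatorname{div}_h$ are elementwise. *Flow discretization.* Let $H_h^B$ be the piecewise $P^k$ vector fields on $\Omega_B$ with $[v\cdot n]=0$ on $\mathcal F_{dl,B}$; $W_h^B$ the piecewise $P^k$ matrix fields on $\Omega_B$ with $[Gn]=0$ on $\mathcal F_{pr,B}^0$, $[(Gn)\cdot t]=0$ on $\mathcal F_{dl,B}$, $Gn=0$ on $\partial\Omega_B$; $Q_h^B$ the piecewise $P^k$ functions on $\Omega_B$ with $[q]=0$ on $\mathcal F_{pr,B}^0$, and $Q_h^0=\{q\in Q_h^B:\int_{\Omega_B}q=0\}$; $H_h^D$ the piecewise $P^k$ fields in $H(\mathrm{div};\Omega_D)$, $H_{h,g}^D=\{v\in H_h^D: v\cdot n=\Pi g\text{ on }\Gamma_D\}$ with $\Pi$ the edgewise $L^2$ projection onto $P^k$; and $Q_h^D$ the piecewise $P^{k-1}$ functions on $\Omega_D$. Let $\varepsilon>0$, $\alpha$ a constant symmetric positive definite matrix, $K_D$ a symmetric positive definite tensor field (with $K_D^{-1}$ integrable), $f_B\in L^2(\Omega_B)^2$, $f_D\in L^2(\Omega_D)^2$,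 $f\in Q_h^D$ (extended by $0$ to $\Omega_B$), $g_1\in L^2(\Gamma_B)$, $g_2\in L^2(\Gamma_D)$ with $\int_{\Gamma_B}g_1+\int_{\Gamma_D}g_2=\int_{\Omega_D}f$. Put $$\begin{aligned} B_h^*(v,G)&=\textstyle\sum_{e\in\mathcal F_{dl,B}}([Gn],(v\cdot n)n)_e-(\operatorname{div}_hG,v)_{\Omega_B},\\ B_h(G,v)&=-\textstyle\sum_{e\in\mathcal F_{pr,B}^0}(Gn,[v])_e-\sum_{e\in\mathcal F_{dl,B}}((Gn)\cdot t,[v\cdot t])_e+(G,\nabla_hv)_{\Omega_B},\\ b_h^*(q,v)&=\textstyle\sum_{e\in\mathcal F_{pr,B}}([v\cdot n],q)_e+(v\cdot n_B,q)_\Gamma-(q,\operatorname{div}_hv)_{\Omega_B},\\ b_h(v,q)&=-\textstyle\sum_{e\in\mathcal F_{dl,B}}(v\cdot n,[q])_e+(v,\nabla_hq)_{\Omega_B},\\ A_h(v,q)&=(q,\operatorname{div}v)_{\Omega_D},\qquad I_h(q,v)=(v\cdot n_D,q)_\Gamma . \end{aligned}$$ Let $(L_h,u_{B,h},p_{B,h})\in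 W_h^B\times H_h^B\times Q_h^0$ and $(u_{D,h},p_{D,h})\in H_{h,g_2}^D\times Q_h^D$ satisfy $$\begin{aligned} (\varepsilon^{-1}L_h,G)_{\Omega_B}-B_h^*(u_{B,h},G)+(K_D^{-1}u_{D,h},v_D)_{\Omega_D}+I_h(p_{B,h},v_D)-A_h(v_D,p_{D,h})&=(f_D,v_D)_{\Omega_D},\\ B_h(L_h,v_B)+(\alpha u_{B,h},v_B)_{\Omega_B}+b_h^*(p_{B,h},v_B)+A_h(u_{D,h},q_D)&=(f_B,v_B)_{\Omega_B}+(f,q_D)_{\Omega_D},\\ -I_h(q_B,u_{D,h})-b_h(u_{B,h},q_B)&=-(g_1,q_B)_{\Gamma_B} \end{aligned}$$ for all $G\in W_h^B$, $v_B\in H_h^B$, $q_B\in Q_h^0$, $v_D\in H_{h,0}^D$, $q_D\in Q_h^D$; let $u_h|_{\Omega_i}=u_{i,h}$. Let $u$ be any vector field with $u\cdot n=g_1$ on $\Gamma_B$ and $u\cdot n=g_2$ on $\Gamma_D$, in particular the exact velocity of the Brinkman–Darcy problem with these boundary data; $\Gamma_{\rm in}=\{x\in\partial\Omega:u\cdot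 n<0\}$, $\Gamma_{\rm out}=\partial\Omega\setminus\Gamma_{\rm in}$. *Transport discretization.* Let $T>0$, $N\ge1$ an integer, $\Delta t=T/N$, $t_n=n\Delta t$. Let $\phi=1$ in $\Omega_B$ and $0<\phi_*\le\phi\le\phi^*$ in $\Omega_D$. For $1\le n\le N+1$ let $K^n=K(\cdot,t_n)$ be a symmetric positive definite tensor field on $\Omega$ (with integrable inverse), $s^n=s(\cdot,t_n)\in L^2(\Omega)$, and let the data $\hat c=\hat c(\cdot,t_n)$, $c_{\rm in}=c_{\rm in}(\cdot,t_n)$ (possibly time dependent) be measurable with $(\hat c^2,f^+)_{\Omega_D}<\infty$ and $(|u\cdot n|,c_{\rm in}^2)_{\Gamma_{\rm in}}<\infty$, where $f^\pm=\max\{\pm f,0\}$. Let $c^0\in L^2(\Omega)$. Let $U_h$ be the piecewise $P^k$ functions on $\mathcal T_h$ with $[q]=0$ on $\mathcal F_{pr}^0$, $W_h$ the piecewise $P^k$ vector fields with $[\psi\cdot n]=0$ on $\mathcal F_{dl}$, and $$\begin{aligned} T_h^*(c,\psi)&=(c,\operatorname{div}_h\psi)-\textstyle\sum_{e\in\mathcal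 F_{pr}}(c,[\psi]\cdot n)_e,\qquad T_h(z,q)=-(z,\nabla_hq)+\sum_{e\in\mathcal F_{dl}}(z\cdot n,[q])_e,\\ S_h(c,q)&=\textstyle\sum_{e\in\mathcal F_{dl}}\int_e\{c\}[q]\,u_h\cdot n\,ds+\frac12\sum_{e\in\mathcal F_{dl}}\int_e[c][q]\,|u_h\cdot n|\,ds . \end{aligned}$$ Let $c_h^0$ be the $L^2$-projection of $c^0$ onto $U_h$, and for $0\le n\le N$ let $(z_h^{n+1},c_h^{n+1})\in W_h\times U_h$ satisfy, for all $(\psi,q)\in W_h\times U_h$ and with $K,\hat c,c_{\rm in}$ taken at $t_{n+1}$, $$(K^{-1}z_h^{n+1},\psi)-T_h^*(c_h^{n+1},\psi)=0,$$ $$\begin{aligned} &\Big(\phi\frac{c_h^{n+1}-c_h^n}{\Delta t},q\Big)+(c_h^{n+1}f^-,q)+T_h(z_h^{n+1},q)-(u_hc_h^{n+1},\nabla_hq)+S_h(c_h^{n+1},q)+(u_h\cdot n\,c_h^{n+1},q)_{\Gamma_{\rm out}}\\ &+\tfrac12((u-u_h)\cdot n\,c_h^{n+1},q)_{\Gamma_{\rm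 out}}-\tfrac12((u-u_h)\cdot n\,c_h^{n+1},q)_{\Gamma_{\rm in}}=(\phi s^{n+1},q)-(c_{\rm in}u\cdot n,q)_{\Gamma_{\rm in}}+(\hat cf^+,q). \end{aligned}$$ *Conclusion.* There is a constant $C>0$ depending only on $T,\phi_*,\phi^*$ (not on the regions, the mesh, $k$, $N$, $\Delta t$ or the remaining data), such that, without any restriction on $\Delta t$, $$\begin{aligned} 2\Delta t\sum_{n=0}^N\|K^{-\frac12}z_h^{n+1}\|_0^2+\|\phi^{\frac12}c_h^{N+1}\|_0^2\le C\Big(&\sum_{n=0}^N\Delta t\|\phi^{\frac12}s^{n+1}\|_0^2+\sum_{n=0}^N\Delta t\,(|u\cdot n|,c_{\rm in}^2)_{\Gamma_{\rm in}}\\ &+\sum_{n=0}^N\Delta t\,(\hat c^2,f^+)_{\Omega_D}+\phi^*\|c^0\|_0^2\Big). \end{aligned}$$ -/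

import Mathlib

open MeasureTheory Matrix

noncomputable section

namespace BrinkmanDarcy

/-- Points of the plane, with the Euclidean distance and Lebesgue measure. -/
abbrev Pt : Type := EuclideanSpace ℝ (Fin 2)

/-- Components of a plane vector; scalar products are written `⬝ᵥ`. -/
abbrev Vec : Type := Fin 2 → ℝ

/-- Real polynomials in two variables. -/
abbrev Poly : Type := MvPolynomial (Fin 2) ℝ

/-- Value of a polynomial at a point. -/
def ev (p : Poly) (x : Pt) : ℝ := MvPolynomial.eval (fun i => x i) p

/-- Value of a polynomial vector field at a point. -/
def evV (v : Fin 2 → Poly) (x : Pt) : Vec := fun i => ev (v i) x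

/-- Value of a polynomial matrix field at a point. -/
def evM (G : Fin 2 → Fin 2 → Poly) (x : Pt) : Matrix (Fin 2) (Fin 2) ℝ :=
  Matrix.of fun i j => ev (G i j) x

/-- The gradient of a scalar polynomial. -/
def grad (q : Poly) : Fin 2 → Poly := fun i => MvPolynomial.pderiv i q

/-- The divergence of a polynomial vector field. -/
def divV (v : Fin 2 → Poly) : Poly := ∑ i, MvPolynomial.pderiv i (v i)

/-- The gradient of a polynomial vector field, `(∇v)ᵢⱼ = ∂ⱼ vᵢ`. -/
def gradV (v : Fin 2 → Poly) : Fin 2 → Fin 2 → Poly := fun i j => MvPolynomial.pderiv j (v i)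

/-- The row-wise divergence of a polynomial matrix field. -/
def divM (G : Fin 2 → Fin 2 → Poly) : Fin 2 → Poly := fun i => ∑ j, MvPolynomial.pderiv j (G i j)

/-- The point with parameter `s ∈ [0,1]` on the segment from `p` to `q`. -/
def segPt (p q : Pt) (s : ℝ) : Pt := AffineMap.lineMap p q s

/-- The unit tangent of the segment from `p` to `q`. -/
def tang (p q : Pt) : Vec := fun i => (q i - p i) / dist p q

/-- The unit normal on the right-hand side of the segment from `p` to `q`: the outward normal of a
triangle whose boundary is traversed counterclockwise. -/
def nrm (p q : Pt) : Vec := ![(q 1 - p 1) / dist p q, -((q 0 - p 0) / dist p q)]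

/-- The integral of `F` over the segment from `p` to `q` with respect to arc length. -/
def segInt (p q : Pt) (F : Pt → ℝ) : ℝ := dist p q * ∫ s in (0 : ℝ)..1, F (segPt p q s)

/-- The two flow regions, `Ω_B` and `Ω_D`. -/
inductive Region : Type
  | B : Region
  | D : Region
  deriving DecidableEq

/-- A conforming triangulation `𝒯_h` of `Ω = Ω_B ∪ Ω_D` that comes from a primal partition of the
two regions into triangles and quadrilaterals by joining an interior point of each primal element
to its vertices. Thus each triangle `t` has one primal edge, from `a t` to `b t`, and its third
vertex `ν t` is the chosen point of the primal element that contains it; `Ω_B` and `Ω_D` are the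
polygonal regions covered by the triangles with the corresponding label.

* `next t` is the following triangle, counterclockwise, in the same primal element. The two of them
  share the dual edge from `b t` to `ν t`; so the dual edges are indexed by the triangles.
* `twin t` is the triangle on the other side of the primal edge of `t`, if there is one, and
  `twin t = t` if the primal edge of `t` lies on the boundary of `Ω`.
* `lead` picks one of the two triangles at each interior primal edge. This fixes the normal of the
  edge (outward from the picked triangle), and makes `lead` the index set of the primal edges. -/
structure Mesh where
  /-- the index set of the triangles -/
  T : Type
  [fin : Fintype T]
  [dec : DecidableEq T]
  a : T → Pt
  b : T → Pt
  ν : T → Pt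
  reg : T → Region
  next : Equiv.Perm T
  twin : T → T
  lead : Finset T
  /-- each triangle `(a t, b t, ν t)` is non-degenerate and counterclockwise -/
  orient : ∀ t, 0 < (b t 0 - a t 0) * (ν t 1 - a t 1) - (b t 1 - a t 1) * (ν t 0 - a t 0)
  a_next : ∀ t, a (next t) = b t
  ν_next : ∀ t, ν (next t) = ν t
  reg_next : ∀ t, reg (next t) = reg t
  /-- a primal element is a triangle or a quadrilateral -/
  ring : ∀ t, next (next (next t)) = t ∨ next (next (next (next t))) = t
  twin_twin : ∀ t, twin (twin t) = t
  twin_edge : ∀ t, twin t ≠ t → a (twin t) = b t ∧ b (twin t) = a t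
  /-- boundary primal edges belong to one triangle only -/
  twin_unique : ∀ t t', t ≠ t' → a t' = b t → b t' = a t → t' = twin t
  lead_interior : ∀ t, twin t ≠ t → (t ∈ lead ↔ twin t ∉ lead)
  lead_boundary : ∀ t, twin t = t → t ∈ lead
  /-- two different triangles meet in a common edge, a common vertex, or not at all -/
  conforming : ∀ t t', t ≠ t' →
    convexHull ℝ {a t, b t, ν t} ∩ convexHull ℝ {a t', b t', ν t'} =
      convexHull ℝ (({a t, b t, ν t} : Set Pt) ∩ {a t', b t', ν t'})

attribute [instance] Mesh.fin Mesh.dec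

namespace Mesh

variable (M : Mesh)

/-- The closed triangle with index `t`. -/
def tri (t : M.T) : Set Pt := convexHull ℝ {M.a t, M.b t, M.ν t}

/-- The integral over the region `r`. Triangles overlap in null sets only. -/
def intReg (r : Region) (F : M.T → Pt → ℝ) : ℝ :=
  ∑ t with M.reg t = r, ∫ x in M.tri t, F t x

/-- The integral over `Ω`. -/
def intAll (F : M.T → Pt → ℝ) : ℝ := ∑ t, ∫ x in M.tri t, F t x

/-- Arc-length integral over the primal edge of `t`. -/
def intPr (t : M.T) (F : Pt → ℝ) : ℝ := segInt (M.a t) (M.b t) F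

/-- Arc-length integral over the dual edge between `t` and `next t`. -/
def intDl (t : M.T) (F : Pt → ℝ) : ℝ := segInt (M.b t) (M.ν t) F

/-- Unit normal of the primal edge of `t`, outward from `t`. -/
def nPr (t : M.T) : Vec := nrm (M.a t) (M.b t)

/-- Unit normal of the dual edge between `t` and `next t`, pointing from `t` to `next t`. -/
def nDl (t : M.T) : Vec := nrm (M.b t) (M.ν t)

/-- Unit tangent of the dual edge between `t` and `next t`. -/
def tDl (t : M.T) : Vec := tang (M.b t) (M.ν t)

/-- Points of the primal edge of `t`. -/
def ptPr (t : M.T) (s : ℝ) : Pt := segPt (M.a t) (M.b t) s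

/-- Points of the dual edge between `t` and `next t`. -/
def ptDl (t : M.T) (s : ℝ) : Pt := segPt (M.b t) (M.ν t) s

/-- Interior primal edges of the region `r` (interface edges excluded). -/
def prInt (r : Region) : Finset M.T :=
  M.lead.filter fun t => M.twin t ≠ t ∧ M.reg t = r ∧ M.reg (M.twin t) = r

/-- Primal edges on the part of `∂Ω` that belongs to the region `r`: `Γ_B` or `Γ_D`. -/
def bdry (r : Region) : Finset M.T := Finset.univ.filter fun t => M.twin t = t ∧ M.reg t = r

/-- Primal edges of the region `r` (interface edges excluded). -/
def pr (r : Region) : Finset M.T := M.prInt r ∪ M.bdry r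

/-- Interface edges, indexed by their triangle in `Ω_B`. -/
def iface : Finset M.T :=
  Finset.univ.filter fun t => M.reg t = Region.B ∧ M.reg (M.twin t) = Region.D

/-- Jump over the primal edge of `t` (for the normal `nPr t`) of the piecewise function `v`; the
trace itself on an edge in `∂Ω`. -/
def jumpPr {V : Type} [AddCommGroup V] (v : M.T → Pt → V) (t : M.T) (x : Pt) : V :=
  if M.twin t = t then v t x else v t x - v (M.twin t) x

/-- Jump over the dual edge between `t` and `next t` (for the normal `nDl t`). -/
def jumpDl {V : Type} [AddCommGroup V] (v : M.T → Pt → V) (t : M.T) (x : Pt) : V :=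
  v t x - v (M.next t) x

/-- Average over the dual edge between `t` and `next t`. -/
def avgDl (v : M.T → Pt → ℝ) (t : M.T) (x : Pt) : ℝ := (v t x + v (M.next t) x) / 2

/-- Piecewise polynomial scalar functions. -/
abbrev Sca : Type := M.T → Poly

/-- Piecewise polynomial vector functions. -/
abbrev VecF : Type := M.T → Fin 2 → Poly

/-- Piecewise polynomial matrix functions. -/
abbrev MatF : Type := M.T → Fin 2 → Fin 2 → Poly

variable {M}

/-- The function represented by a piecewise polynomial. -/
def fn (q : M.Sca) : M.T → Pt → ℝ := fun t x => ev (q t) x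

/-- The vector function represented by a piecewise polynomial. -/
def fnV (v : M.VecF) : M.T → Pt → Vec := fun t x => evV (v t) x

/-- The matrix function represented by a piecewise polynomial. -/
def fnM (G : M.MatF) : M.T → Pt → Matrix (Fin 2) (Fin 2) ℝ := fun t x => evM (G t) x

/-! ### Discretization of the flow

Functions on `Ω_B` or `Ω_D` alone are families indexed by all triangles of which only the members
in the region concerned are used. -/

/-- The space `H_h^B`. -/
def IsHB (k : ℕ) (v : M.VecF) : Prop :=
  ∀ t, M.reg t = Region.B →
    (∀ i, (v t i).totalDegree ≤ k) ∧
    ∀ s ∈ Set.Icc (0 : ℝ) 1, M.jumpDl (fnV v) t (M.ptDl t s) ⬝ᵥ M.nDl t = 0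

/-- The space `W_h^B`. -/
def IsWB (k : ℕ) (G : M.MatF) : Prop :=
  (∀ t, M.reg t = Region.B →
    (∀ i j, (G t i j).totalDegree ≤ k) ∧
    ∀ s ∈ Set.Icc (0 : ℝ) 1,
      (M.jumpDl (fnM G) t (M.ptDl t s) *ᵥ M.nDl t) ⬝ᵥ M.tDl t = 0) ∧
  (∀ t ∈ M.prInt Region.B, ∀ s ∈ Set.Icc (0 : ℝ) 1,
      M.jumpPr (fnM G) t (M.ptPr t s) *ᵥ M.nPr t = 0) ∧
  (∀ t ∈ M.bdry Region.B ∪ M.iface, ∀ s ∈ Set.Icc (0 : ℝ) 1,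
      fnM G t (M.ptPr t s) *ᵥ M.nPr t = 0)

/-- The space `Q_h^B`. -/
def IsQB (k : ℕ) (q : M.Sca) : Prop :=
  (∀ t, M.reg t = Region.B → (q t).totalDegree ≤ k) ∧
  ∀ t ∈ M.prInt Region.B, ∀ s ∈ Set.Icc (0 : ℝ) 1, M.jumpPr (fn q) t (M.ptPr t s) = 0

/-- The space `Q_h^0`. -/
def IsQ0 (k : ℕ) (q : M.Sca) : Prop := IsQB k q ∧ M.intReg Region.B (fn q) = 0

/-- The space `H_h^D`: piecewise polynomial fields in `H(div; Ω_D)`, that is, with continuous normal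
components over the dual edges and the interior primal edges of `Ω_D`. -/
def IsHD (k : ℕ) (v : M.VecF) : Prop :=
  (∀ t, M.reg t = Region.D →
    (∀ i, (v t i).totalDegree ≤ k) ∧
    ∀ s ∈ Set.Icc (0 : ℝ) 1, M.jumpDl (fnV v) t (M.ptDl t s) ⬝ᵥ M.nDl t = 0) ∧
  ∀ t ∈ M.prInt Region.D, ∀ s ∈ Set.Icc (0 : ℝ) 1,
    M.jumpPr (fnV v) t (M.ptPr t s) ⬝ᵥ M.nPr t = 0

/-- The space `H_{h,g}^D`: on each edge of `Γ_D` the normal component is the `L²` projection of `g`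
onto the polynomials of degree at most `k`. -/
def IsHDg (k : ℕ) (g : Pt → ℝ) (v : M.VecF) : Prop :=
  IsHD k v ∧ ∀ t ∈ M.bdry Region.D, ∀ χ : Poly, χ.totalDegree ≤ k →
    M.intPr t (fun x => (g x - fnV v t x ⬝ᵥ M.nPr t) * ev χ x) = 0

/-- The space `Q_h^D`. -/
def IsQD (k : ℕ) (q : M.Sca) : Prop := ∀ t, M.reg t = Region.D → (q t).totalDegree ≤ k - 1

/-- `B_h^*(u, G)` -/
def formBstar (u : M.VecF) (G : M.MatF) : ℝ :=
  (∑ t with M.reg t = Region.B, M.intDl t fun x =>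
    (M.jumpDl (fnM G) t x *ᵥ M.nDl t) ⬝ᵥ ((fnV u t x ⬝ᵥ M.nDl t) • M.nDl t))
  - M.intReg Region.B fun t x => evV (divM (G t)) x ⬝ᵥ fnV u t x

/-- `B_h(L, v)` -/
def formB (L : M.MatF) (v : M.VecF) : ℝ :=
  - (∑ t ∈ M.prInt Region.B, M.intPr t fun x =>
      (fnM L t x *ᵥ M.nPr t) ⬝ᵥ M.jumpPr (fnV v) t x)
  - (∑ t with M.reg t = Region.B, M.intDl t fun x =>
      ((fnM L t x *ᵥ M.nDl t) ⬝ᵥ M.tDl t) * (M.jumpDl (fnV v) t x ⬝ᵥ M.tDl t))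
  + M.intReg Region.B fun t x => ∑ i, ∑ j, fnM L t x i j * evM (gradV (v t)) x i j

/-- `b_h^*(p, v)` -/
def formbstar (p : M.Sca) (v : M.VecF) : ℝ :=
  (∑ t ∈ M.pr Region.B, M.intPr t fun x => (M.jumpPr (fnV v) t x ⬝ᵥ M.nPr t) * fn p t x)
  + (∑ t ∈ M.iface, M.intPr t fun x => (fnV v t x ⬝ᵥ M.nPr t) * fn p t x)
  - M.intReg Region.B fun t x => fn p t x * ev (divV (v t)) x

/-- `b_h(u, q)` -/
def formb (u : M.VecF) (q : M.Sca) : ℝ :=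
  - (∑ t with M.reg t = Region.B, M.intDl t fun x =>
      (fnV u t x ⬝ᵥ M.nDl t) * M.jumpDl (fn q) t x)
  + M.intReg Region.B fun t x => fnV u t x ⬝ᵥ evV (grad (q t)) x

/-- `A_h(v, p)` -/
def formA (v : M.VecF) (p : M.Sca) : ℝ :=
  M.intReg Region.D fun t x => fn p t x * ev (divV (v t)) x

/-- `I_h(p, v)`, with `p` taken from the `Ω_B` side and `v` from the `Ω_D` side of the interface,
and with the normal outward from `Ω_D`. -/
def formI (p : M.Sca) (v : M.VecF) : ℝ :=
  ∑ t ∈ M.iface, M.intPr t fun x => (fnV v (M.twin t) x ⬝ᵥ (- M.nPr t)) * fn p t x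

/-- `(L_h, u_h|_{Ω_B}, p_{B,h}, u_h|_{Ω_D}, p_{D,h})` solves the discrete Brinkman-Darcy problem. -/
def IsFlowSolution (k : ℕ) (ε : ℝ) (α : Matrix (Fin 2) (Fin 2) ℝ)
    (KD : Pt → Matrix (Fin 2) (Fin 2) ℝ) (fB fD : Pt → Vec) (f : M.Sca) (g₁ g₂ : Pt → ℝ)
    (L : M.MatF) (uh : M.VecF) (pB pD : M.Sca) : Prop :=
  IsWB k L ∧ IsHB k uh ∧ IsQ0 k pB ∧ IsHDg k g₂ uh ∧ IsQD k pD ∧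
  (∀ (G : M.MatF) (vD : M.VecF), IsWB k G → IsHDg k (fun _ => 0) vD →
    (M.intReg Region.B fun t x => ∑ i, ∑ j, ε⁻¹ * fnM L t x i j * fnM G t x i j)
      - formBstar uh G
      + (M.intReg Region.D fun t x => ((KD x)⁻¹ *ᵥ fnV uh t x) ⬝ᵥ fnV vD t x)
      + formI pB vD - formA vD pD
      = M.intReg Region.D fun t x => fD x ⬝ᵥ fnV vD t x) ∧
  (∀ (vB : M.VecF) (qD : M.Sca), IsHB k vB → IsQD k qD →
    formB L vB
      + (M.intReg Region.B fun t x => (α *ᵥ fnV uh t x) ⬝ᵥ fnV vB t x)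
      + formbstar pB vB + formA uh qD
      = (M.intReg Region.B fun t x => fB x ⬝ᵥ fnV vB t x)
        + M.intReg Region.D fun t x => fn f t x * fn qD t x) ∧
  (∀ qB : M.Sca, IsQ0 k qB →
    - formI qB uh - formb uh qB
      = - ∑ t ∈ M.bdry Region.B, M.intPr t fun x => g₁ x * fn qB t x)

/-! ### Discretization of the transport -/

/-- The space `U_h`. -/
def IsU (k : ℕ) (q : M.Sca) : Prop :=
  (∀ t, (q t).totalDegree ≤ k) ∧
  ∀ t ∈ M.lead, M.twin t ≠ t → ∀ s ∈ Set.Icc (0 : ℝ) 1,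
    M.jumpPr (fn q) t (M.ptPr t s) = 0

/-- The space `W_h`. -/
def IsW (k : ℕ) (ψ : M.VecF) : Prop :=
  ∀ t, (∀ i, (ψ t i).totalDegree ≤ k) ∧
    ∀ s ∈ Set.Icc (0 : ℝ) 1, M.jumpDl (fnV ψ) t (M.ptDl t s) ⬝ᵥ M.nDl t = 0

/-- `T_h^*(c, ψ)` -/
def formTstar (c : M.Sca) (ψ : M.VecF) : ℝ :=
  (M.intAll fun t x => fn c t x * ev (divV (ψ t)) x)
  - ∑ t ∈ M.lead, M.intPr t fun x => fn c t x * (M.jumpPr (fnV ψ) t x ⬝ᵥ M.nPr t)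

/-- `T_h(z, q)` -/
def formT (z : M.VecF) (q : M.Sca) : ℝ :=
  - (M.intAll fun t x => fnV z t x ⬝ᵥ evV (grad (q t)) x)
  + ∑ t, M.intDl t fun x => (fnV z t x ⬝ᵥ M.nDl t) * M.jumpDl (fn q) t x

/-- `S_h(c, q)`, with the velocity `u_h` -/
def formS (uh : M.VecF) (c q : M.Sca) : ℝ :=
  (∑ t, M.intDl t fun x =>
    M.avgDl (fn c) t x * M.jumpDl (fn q) t x * (fnV uh t x ⬝ᵥ M.nDl t))
  + (1 / 2) * ∑ t, M.intDl t fun x =>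
    M.jumpDl (fn c) t x * M.jumpDl (fn q) t x * |fnV uh t x ⬝ᵥ M.nDl t|

/-- The integral over `Γ_in`, the part of `∂Ω` where `u · n < 0`. -/
def intIn (u : Pt → Vec) (F : M.T → Pt → ℝ) : ℝ :=
  ∑ t with M.twin t = t, M.intPr t fun x => if u x ⬝ᵥ M.nPr t < 0 then F t x else 0

/-- The integral over `Γ_out`, the part of `∂Ω` where `u · n ≥ 0`. -/
def intOut (u : Pt → Vec) (F : M.T → Pt → ℝ) : ℝ :=
  ∑ t with M.twin t = t, M.intPr t fun x => if 0 ≤ u x ⬝ᵥ M.nPr t then F t x else 0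

/-- `‖K^{-1/2} z‖₀² = (K⁻¹ z, z)` -/
def energyK (K : Pt → Matrix (Fin 2) (Fin 2) ℝ) (z : M.VecF) : ℝ :=
  M.intAll fun t x => ((K x)⁻¹ *ᵥ fnV z t x) ⬝ᵥ fnV z t x

/-- One step of the backward Euler scheme for the transport equation: `(z, c)` is the solution at
the new time level, `cOld` the concentration at the old one, and `K`, `s`, `cHat`, `cIn` are the
data at the new time level. -/
def IsTransportStep (k : ℕ) (Δt : ℝ) (φ : Pt → ℝ) (f : M.Sca) (u : Pt → Vec) (uh : M.VecF)
    (K : Pt → Matrix (Fin 2) (Fin 2) ℝ) (s cHat cIn : Pt → ℝ)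
    (cOld : M.Sca) (z : M.VecF) (c : M.Sca) : Prop :=
  IsW k z ∧ IsU k c ∧
  (∀ ψ : M.VecF, IsW k ψ →
    (M.intAll fun t x => ((K x)⁻¹ *ᵥ fnV z t x) ⬝ᵥ fnV ψ t x) - formTstar c ψ = 0) ∧
  (∀ q : M.Sca, IsU k q →
    (M.intAll fun t x => φ x * ((fn c t x - fn cOld t x) / Δt) * fn q t x)
      + (M.intAll fun t x => fn c t x * max (-fn f t x) 0 * fn q t x)
      + formT z q
      - (M.intAll fun t x => (fn c t x • fnV uh t x) ⬝ᵥ evV (grad (q t)) x)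
      + formS uh c q
      + (intOut u fun t x => (fnV uh t x ⬝ᵥ M.nPr t) * fn c t x * fn q t x)
      + (1 / 2) * (intOut u fun t x => ((u x - fnV uh t x) ⬝ᵥ M.nPr t) * fn c t x * fn q t x)
      - (1 / 2) * (intIn u fun t x => ((u x - fnV uh t x) ⬝ᵥ M.nPr t) * fn c t x * fn q t x)
      = (M.intAll fun t x => φ x * s x * fn q t x)
        - (intIn u fun t x => cIn x * (u x ⬝ᵥ M.nPr t) * fn q t x)
        + M.intAll fun t x => cHat x * max (fn f t x) 0 * fn q t x)

/-- `ch` is the `L²`-orthogonal projection of `c₀` onto `U_h`. -/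
def IsL2Proj (k : ℕ) (c₀ : Pt → ℝ) (ch : M.Sca) : Prop :=
  IsU k ch ∧ ∀ q : M.Sca, IsU k q → (M.intAll fun t x => (c₀ x - fn ch t x) * fn q t x) = 0

/-- `A` is symmetric positive definite almost everywhere in `S`, and `A⁻¹` is integrable there, so
that `∫_S A⁻¹ v · w` makes sense for polynomials `v`, `w`. -/
def IsSPDOn (S : Set Pt) (A : Pt → Matrix (Fin 2) (Fin 2) ℝ) : Prop :=
  (∀ᵐ x ∂(volume.restrict S), (A x).PosDef) ∧
  ∀ i j, IntegrableOn (fun x => (A x)⁻¹ i j) S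

end Mesh

end BrinkmanDarcy

end

namespace BrinkmanDarcy

/-! ### Polynomials as functions -/

/-! The proof has two halves: the discrete velocity is shown to be exactly conservative, and then
the transport scheme is tested with its own solution.

Conservation. In `Ω_D` the residual `f - div u_h` is an admissible test function, so `div u_h = f`
(`ae_div_eq_of_D`). The divergence theorem on `Ω_D` and the compatibility of the data then give the
flux through the interface, and with it the continuity equation extends from mean-zero test
functions to all of `Q_h^B` (`continuity_eq_of_isQB`). After elementwise integration by parts two
test functions suffice. Since every triangle has exactly one primal edge, `div u_h` times a linear
function vanishing on that edge is admissible and yields `div u_h = 0` in `Ω_B`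
(`ae_div_eq_zero_of_B`). The normal jump of `u_h`, extended as a polynomial to both neighbours, is
admissible too and yields continuity of `u_h · n` over the primal edges of `Ω_B` and the interface
(`normalContinuous_of_flow`).

Energy. With `q = c` and `ψ = z`, adjointness of `T_h` and `T_h^*` produces `‖K^{-1/2} z‖²`.
Convection reduces to `½ ∫ c² div u_h`, a nonnegative upwind term on the dual edges and a flux
through primal edges. Interior primal fluxes cancel, and on `∂Ω` the corrections with `u - u_h` turn
the remainder into `½ ∫ |u · n| c²` (`boundary_identity`). As `div u_h = f⁺ - f⁻`, the terms `½ f⁺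
c²` and `½ |u · n| c²` absorb the injection and inflow data by Young's inequality.

Time. Backward Euler also controls `‖φ^{1/2}(c^{n+1} - c^n)‖²`. Writing `c^{n+1} = c^n + (c^{n+1} -
c^n)` in the source term, the increment is absorbed there and the growth factor `1 + Δt/T` falls on
the old level only (`source_le`). This is why no bound on `Δt` is needed. `discrete_gronwall`
finishes, because `(1 + 1/N)^(N+1) ≤ e²`. -/

@[simp] lemma ev_zero (x : Pt) : ev 0 x = 0 := by simp [ev]

@[simp] lemma ev_one (x : Pt) : ev 1 x = 1 := by simp [ev]

@[simp] lemma ev_C (r : ℝ) (x : Pt) : ev (MvPolynomial.C r) x = r := by simp [ev]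

@[simp] lemma ev_X (i : Fin 2) (x : Pt) : ev (MvPolynomial.X i) x = x i := by simp [ev]

@[simp] lemma ev_add (p q : Poly) (x : Pt) : ev (p + q) x = ev p x + ev q x := by simp [ev]

@[simp] lemma ev_sub (p q : Poly) (x : Pt) : ev (p - q) x = ev p x - ev q x := by simp [ev]

@[simp] lemma ev_mul (p q : Poly) (x : Pt) : ev (p * q) x = ev p x * ev q x := by simp [ev]

@[fun_prop] lemma continuous_ev (p : Poly) : Continuous (ev p) := by
  have h : Continuous fun x : Pt => fun i : Fin 2 => x i := by fun_prop
  exact (MvPolynomial.continuous_eval p).comp h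

/-- Links the formal derivatives of a polynomial to calculus; it is the only differentiation behind
the divergence theorem below. -/
lemma hasDerivAt_ev_line (g : Poly) (p w : Pt) (s : ℝ) :
    HasDerivAt (fun s : ℝ => ev g (p + s • w))
      (ev (MvPolynomial.pderiv 0 g) (p + s • w) * w 0
        + ev (MvPolynomial.pderiv 1 g) (p + s • w) * w 1) s := by
  induction g using MvPolynomial.induction_on with
  | C r => simpa using hasDerivAt_const s r
  | add f g hf hg =>
    have := hf.add hg
    simp only [map_add, ev_add]
    exact this.congr_deriv (by ring)
  | mul_X f i hf =>
    have hX : HasDerivAt (fun s : ℝ => ev (MvPolynomial.X i) (p + s • w)) (w i) s := by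
      simp only [ev_X, PiLp.add_apply, PiLp.smul_apply, smul_eq_mul]
      simpa using ((hasDerivAt_id s).mul_const (w i)).const_add (p i)
    have := hf.mul hX
    simp only [ev_mul]
    refine this.congr_deriv ?_
    rw [Derivation.leibniz, Derivation.leibniz]
    fin_cases i <;> simp [MvPolynomial.pderiv_X] <;> ring

/-! ### Integration over a triangle -/

/-- The triangle with vertices `(0,0)`, `(1,0)`, `(0,1)`. -/
def refTri : Set (ℝ × ℝ) := {z | 0 ≤ z.1 ∧ 0 ≤ z.2 ∧ z.1 + z.2 ≤ 1}

lemma isClosed_refTri : IsClosed refTri := by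
  refine (isClosed_le continuous_const continuous_fst).inter
    ((isClosed_le continuous_const continuous_snd).inter
      (isClosed_le (continuous_fst.add continuous_snd) continuous_const))

lemma refTri_subset : refTri ⊆ Set.Icc 0 1 ×ˢ Set.Icc 0 1 := by
  rintro ⟨x, y⟩ ⟨h1, h2, h3⟩
  simp only at h1 h2 h3
  constructor <;> constructor <;> simp <;> linarith

lemma setIntegral_refTri (h : ℝ × ℝ → ℝ) (hh : Continuous h) :
    ∫ z in refTri, h z = ∫ x in (0 : ℝ)..1, ∫ y in (0 : ℝ)..(1 - x), h (x, y) := by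
  have hm := isClosed_refTri.measurableSet
  have hc : IsCompact refTri :=
    (isCompact_Icc.prod isCompact_Icc).of_isClosed_subset isClosed_refTri refTri_subset
  have hi : Integrable (refTri.indicator h) :=
    (integrable_indicator_iff hm).2 (hh.continuousOn.integrableOn_compact hc)
  rw [← integral_indicator hm, Measure.volume_eq_prod,
    integral_prod _ (by rwa [← Measure.volume_eq_prod]),
    intervalIntegral.integral_of_le zero_le_one, ← integral_Icc_eq_integral_Ioc,
    ← integral_indicator measurableSet_Icc]
  congr 1
  ext x
  by_cases hx : x ∈ Set.Icc (0 : ℝ) 1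
  · rw [Set.indicator_of_mem hx, intervalIntegral.integral_of_le (by linarith [hx.2]),
      ← integral_Icc_eq_integral_Ioc, ← integral_indicator measurableSet_Icc]
    congr 1
    ext y
    refine Set.indicator_eq_indicator ?_ rfl
    simp only [refTri, Set.mem_ofPred_eq, Set.mem_Icc]
    constructor
    · rintro ⟨_, h2, h3⟩; exact ⟨h2, by linarith⟩
    · rintro ⟨h2, h3⟩; exact ⟨hx.1, h2, by linarith⟩
  · rw [Set.indicator_of_notMem hx]
    have : ∀ y, refTri.indicator h (x, y) = 0 := fun y =>
      Set.indicator_of_notMem (fun hm => hx (refTri_subset hm).1) _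
    simp [this]

/-- The plane as a product. -/
def toPt (z : ℝ × ℝ) : Pt := WithLp.toLp 2 ![z.1, z.2]

lemma measurePreserving_toPt : MeasurePreserving toPt := by
  have h1 := (volume_preserving_finTwoArrow ℝ).symm
  have h2 := PiLp.volume_preserving_toLp (Fin 2)
  exact h2.comp h1

lemma measurableEmbedding_toPt : MeasurableEmbedding toPt := by
  exact (MeasurableEquiv.toLp 2 (Fin 2 → ℝ)).measurableEmbedding.comp
    (MeasurableEquiv.finTwoArrow (α := ℝ)).symm.measurableEmbedding

/-- Twice the signed area of a triangle. -/
def det3 (p q r : Pt) : ℝ := (q 0 - p 0) * (r 1 - p 1) - (q 1 - p 1) * (r 0 - p 0)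

lemma mem_convexHull_triple (p q r x : Pt) :
    x ∈ convexHull ℝ ({p, q, r} : Set Pt) ↔
      ∃ z ∈ refTri, x = p + z.1 • (q - p) + z.2 • (r - p) := by
  rw [convexHull_insert (by simp), convexHull_pair, convexJoin_singleton_left]
  simp only [Set.mem_iUnion, segment_eq_image', Set.mem_image, exists_prop]
  constructor
  · rintro ⟨_, ⟨t, ht, rfl⟩, s, hs, rfl⟩
    refine ⟨(s * (1 - t), s * t), ⟨?_, ?_, ?_⟩, ?_⟩
    · exact mul_nonneg hs.1 (by linarith [ht.2])
    · exact mul_nonneg hs.1 ht.1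
    · simp only; linarith [hs.2]
    · simp only; module
  · rintro ⟨⟨y, z⟩, ⟨hy, hz, hyz⟩, rfl⟩
    simp only at hy hz hyz
    -- The point on the opposite side is found by dividing by `y + z`; at the vertex `p` this fails,
    -- and any point of that side will do.
    rcases eq_or_lt_of_le (add_nonneg hy hz) with h0 | h0
    · have : y = 0 := by linarith
      have : z = 0 := by linarith
      subst_vars
      exact ⟨q, ⟨0, by simp, by simp⟩, 0, by simp, by simp⟩
    · refine ⟨_, ⟨z / (y + z), ⟨by positivity, by rw [div_le_one h0]; linarith⟩, rfl⟩, y + z,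
        ⟨h0.le, hyz⟩, ?_⟩
      have : z = (y + z) * (z / (y + z)) := by field_simp
      have h2 : (y + z) • (q + (z / (y + z)) • (r - q) - p)
          = (y + z) • (q - p) + ((y + z) * (z / (y + z))) • (r - q) := by module
      simp only
      rw [h2, ← this]
      module

/-- Change of variables by the affine map from the reference triangle, with constant Jacobian `det3
p q r`. The map is taken from `ℝ × ℝ` to itself, where it has a determinant, and followed by the
measure-preserving `toPt`. -/
lemma setIntegral_triangle (p q r : Pt) (hD : det3 p q r ≠ 0) (F : Pt → ℝ) (hF : Continuous F) :
    ∫ x in convexHull ℝ ({p, q, r} : Set Pt), F x =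
      |det3 p q r| * ∫ x in (0 : ℝ)..1, ∫ y in (0 : ℝ)..(1 - x),
        F (p + x • (q - p) + y • (r - p)) := by
  set A : ℝ × ℝ →L[ℝ] ℝ × ℝ := LinearMap.toContinuousLinearMap
    (Matrix.toLin (Module.Basis.finTwoProd ℝ) (Module.Basis.finTwoProd ℝ)
      !![q 0 - p 0, r 0 - p 0; q 1 - p 1, r 1 - p 1]) with hA
  have hAdet : A.det = det3 p q r := by
    rw [hA, ContinuousLinearMap.det, LinearMap.coe_toContinuousLinearMap, LinearMap.det_toLin,
      Matrix.det_fin_two_of, det3]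
    ring
  have hAapp : ∀ z : ℝ × ℝ, A z = ((q 0 - p 0) * z.1 + (r 0 - p 0) * z.2,
      (q 1 - p 1) * z.1 + (r 1 - p 1) * z.2) := by
    intro z
    rw [hA, Matrix.toLin_finTwoProd_toContinuousLinearMap]
    simp
  set Φ : ℝ × ℝ → ℝ × ℝ := fun z => (p 0, p 1) + A z with hΦ
  have hΦpt : ∀ z, toPt ((p 0, p 1) + A z) = p + z.1 • (q - p) + z.2 • (r - p) := by
    intro z
    ext i
    fin_cases i <;> simp [toPt, hAapp] <;> ring
  have hinj : Set.InjOn Φ refTri := by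
    intro z _ z' _ h
    have h' : A z = A z' := add_left_cancel h
    rw [hAapp, hAapp, Prod.mk.injEq] at h'
    obtain ⟨h1, h2⟩ := h'
    have e1 : det3 p q r * (z.1 - z'.1) = 0 := by
      rw [det3]; linear_combination (r 1 - p 1) * h1 - (r 0 - p 0) * h2
    have e2 : det3 p q r * (z.2 - z'.2) = 0 := by
      rw [det3]; linear_combination (q 0 - p 0) * h2 - (q 1 - p 1) * h1
    have e1' := (mul_eq_zero.1 e1).resolve_left hD
    have e2' := (mul_eq_zero.1 e2).resolve_left hD
    exact Prod.ext (by linarith) (by linarith)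
  have himg : convexHull ℝ ({p, q, r} : Set Pt) = toPt '' (Φ '' refTri) := by
    ext x
    rw [mem_convexHull_triple, Set.image_image]
    simp only [hΦ, hΦpt, Set.mem_image]
    constructor <;> rintro ⟨z, hz, h⟩ <;> exact ⟨z, hz, h.symm⟩
  rw [himg, measurePreserving_toPt.setIntegral_image_emb measurableEmbedding_toPt,
    integral_image_eq_integral_abs_det_fderiv_smul volume isClosed_refTri.measurableSet
      (fun z _ => (A.hasFDerivAt.const_add (p 0, p 1)).hasFDerivWithinAt) hinj]
  simp only [hAdet, smul_eq_mul, hΦpt]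
  rw [integral_const_mul]
  congr 1
  exact setIntegral_refTri (fun z => F (p + z.1 • (q - p) + z.2 • (r - p))) (by fun_prop)

lemma segInt_eq_dist_mul (p q : Pt) (F : Pt → ℝ) :
    segInt p q F = dist p q * ∫ s in (0 : ℝ)..1, F (p + s • (q - p)) := by
  unfold segInt segPt
  congr 2
  ext s
  rw [AffineMap.lineMap_apply]
  simp [add_comm]

lemma integral_line_symm (p q : Pt) (F : Pt → ℝ) :
    ∫ s in (0 : ℝ)..1, F (p + s • (q - p)) = ∫ s in (0 : ℝ)..1, F (q + s • (p - q)) := by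
  have := intervalIntegral.integral_comp_sub_left (a := 0) (b := 1)
    (fun s => F (q + s • (p - q))) (1 : ℝ)
  simp only [sub_self, sub_zero] at this
  rw [← this]
  congr 1
  ext s
  congr 1
  module

/-- In the coordinates `p + x (q - p) + y (r - p)` the integrand is the `y`-derivative of `g`, so
the inner integral is a difference of endpoint values: `y = 0` lies on the side `pq`, `y = 1 - x` on
the side `rq`. -/
lemma setIntegral_deriv_triangle (p q r : Pt) (hD : det3 p q r ≠ 0) (g : Poly) :
    ∫ x in convexHull ℝ ({p, q, r} : Set Pt),
      (ev (MvPolynomial.pderiv 0 g) x * (r - p) 0 + ev (MvPolynomial.pderiv 1 g) x * (r - p) 1) =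
      |det3 p q r| * ((∫ s in (0 : ℝ)..1, ev g (q + s • (r - q)))
        - ∫ s in (0 : ℝ)..1, ev g (p + s • (q - p))) := by
  rw [setIntegral_triangle p q r hD _ (by fun_prop)]
  congr 1
  have : ∀ x : ℝ, ∫ y in (0 : ℝ)..(1 - x),
      (ev (MvPolynomial.pderiv 0 g) (p + x • (q - p) + y • (r - p)) * (r - p) 0
        + ev (MvPolynomial.pderiv 1 g) (p + x • (q - p) + y • (r - p)) * (r - p) 1)
      = ev g (r + x • (q - r)) - ev g (p + x • (q - p)) := by
    intro x
    rw [intervalIntegral.integral_eq_sub_of_hasDerivAt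
      (fun y _ => hasDerivAt_ev_line g (p + x • (q - p)) (r - p) y)
      (Continuous.intervalIntegrable (by fun_prop) _ _)]
    congr 2
    · module
    · simp
  simp only [this]
  rw [intervalIntegral.integral_sub (Continuous.intervalIntegrable (by fun_prop) _ _)
    (Continuous.intervalIntegrable (by fun_prop) _ _), integral_line_symm q r]

/-- The length factor of the arc-length integral cancels the normalisation of `nrm`, so no square
roots remain in the divergence theorem. -/
lemma segInt_nrm (p q : Pt) (hpq : p ≠ q) (v : Fin 2 → Poly) :
    segInt p q (fun x => evV v x ⬝ᵥ nrm p q) =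
      (q 1 - p 1) * (∫ s in (0 : ℝ)..1, ev (v 0) (p + s • (q - p)))
      - (q 0 - p 0) * ∫ s in (0 : ℝ)..1, ev (v 1) (p + s • (q - p)) := by
  have hd : dist p q ≠ 0 := dist_ne_zero.2 hpq
  rw [segInt_eq_dist_mul, ← intervalIntegral.integral_const_mul,
    ← intervalIntegral.integral_const_mul, ← intervalIntegral.integral_const_mul,
    ← intervalIntegral.integral_sub (Continuous.intervalIntegrable (by fun_prop) _ _)
      (Continuous.intervalIntegrable (by fun_prop) _ _)]
  congr 1
  ext s
  simp only [evV, nrm, dotProduct, Fin.sum_univ_two, Matrix.cons_val_zero, Matrix.cons_val_one]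
  field_simp
  ring

/-- The divergence theorem for a polynomial vector field on a counterclockwise triangle. -/
lemma setIntegral_div_triangle (p q r : Pt) (hD : 0 < det3 p q r) (v : Fin 2 → Poly) :
    ∫ x in convexHull ℝ ({p, q, r} : Set Pt), ev (divV v) x =
      segInt p q (fun x => evV v x ⬝ᵥ nrm p q) + segInt q r (fun x => evV v x ⬝ᵥ nrm q r)
        + segInt r p (fun x => evV v x ⬝ᵥ nrm r p) := by
  have hpq : p ≠ q := by rintro rfl; simp [det3] at hD
  have hqr : q ≠ r := by rintro rfl; simp [det3, mul_comm] at hD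
  have hrp : r ≠ p := by rintro rfl; simp [det3] at hD
  have hD' : det3 p r q = -det3 p q r := by simp only [det3]; ring
  have e1 := fun g => setIntegral_deriv_triangle p q r hD.ne' g
  have e2 := fun g => setIntegral_deriv_triangle p r q (by rw [hD']; simpa using hD.ne') g
  simp only [Set.pair_comm r q, hD', abs_neg, abs_of_pos hD] at e1 e2
  have hc : IsCompact (convexHull ℝ ({p, q, r} : Set Pt)) :=
    (Set.toFinite _).isCompact_convexHull (𝕜 := ℝ)
  have hi : ∀ (i : Fin 2) (g : Poly), IntegrableOn (ev (MvPolynomial.pderiv i g))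
      (convexHull ℝ ({p, q, r} : Set Pt)) := fun i g =>
    (continuous_ev _).continuousOn.integrableOn_compact hc
  have hsplit : ∀ (g : Poly) (s t : ℝ), ∫ x in convexHull ℝ ({p, q, r} : Set Pt),
      (ev (MvPolynomial.pderiv 0 g) x * s + ev (MvPolynomial.pderiv 1 g) x * t) =
      (∫ x in convexHull ℝ ({p, q, r} : Set Pt), ev (MvPolynomial.pderiv 0 g) x) * s +
      (∫ x in convexHull ℝ ({p, q, r} : Set Pt), ev (MvPolynomial.pderiv 1 g) x) * t := by
    intro g s t
    rw [integral_add ((hi 0 g).mul_const s) ((hi 1 g).mul_const t), integral_mul_const,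
      integral_mul_const]
  simp only [hsplit, PiLp.sub_apply] at e1 e2
  have hdiv : ∫ x in convexHull ℝ ({p, q, r} : Set Pt), ev (divV v) x =
      (∫ x in convexHull ℝ ({p, q, r} : Set Pt), ev (MvPolynomial.pderiv 0 (v 0)) x) +
      (∫ x in convexHull ℝ ({p, q, r} : Set Pt), ev (MvPolynomial.pderiv 1 (v 1)) x) := by
    rw [← integral_add (hi 0 _) (hi 1 _)]
    simp [divV, Fin.sum_univ_two]
  rw [hdiv, segInt_nrm p q hpq, segInt_nrm q r hqr, segInt_nrm r p hrp]
  have a1 := e1 (v 0)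
  have a2 := e1 (v 1)
  have b1 := e2 (v 0)
  have b2 := e2 (v 1)
  simp only [integral_line_symm r q, integral_line_symm r p] at a1 a2 b1 b2 ⊢
  -- Cramer's rule: the derivatives along `r - p` and `q - p` are known, and `det3 p q r` times each
  -- coordinate derivative is a combination of these two.
  apply mul_left_cancel₀ hD.ne'
  simp only [det3] at *
  linear_combination (r 1 - p 1) * b1 - (q 1 - p 1) * a1 - (r 0 - p 0) * b2 + (q 0 - p 0) * a2

/-! ### Arc-length integrals over segments. -/

lemma segPt_eq (p q : Pt) (s : ℝ) : segPt p q s = p + s • (q - p) := by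
  rw [segPt, AffineMap.lineMap_apply]
  simp [add_comm]

lemma segPt_symm (p q : Pt) (s : ℝ) : segPt q p (1 - s) = segPt p q s := by
  rw [segPt_eq, segPt_eq]
  module

@[fun_prop] lemma continuous_segPt (p q : Pt) : Continuous (segPt p q) := by
  have : segPt p q = fun s => p + s • (q - p) := funext (segPt_eq p q)
  rw [this]
  fun_prop

lemma nrm_symm (p q : Pt) : nrm q p = -nrm p q := by
  ext i
  fin_cases i <;> simp [nrm, dist_comm q p] <;> ring

lemma segInt_symm (p q : Pt) (F : Pt → ℝ) : segInt q p F = segInt p q F := by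
  rw [segInt_eq_dist_mul, segInt_eq_dist_mul, dist_comm, integral_line_symm]

lemma segInt_congr {p q : Pt} {F G : Pt → ℝ}
    (h : ∀ s ∈ Set.Icc (0 : ℝ) 1, F (segPt p q s) = G (segPt p q s)) :
    segInt p q F = segInt p q G := by
  unfold segInt
  congr 1
  refine intervalIntegral.integral_congr fun s hs => h s ?_
  rwa [Set.uIcc_of_le zero_le_one] at hs

lemma segInt_add (p q : Pt) {F G : Pt → ℝ} (hF : Continuous F) (hG : Continuous G) :
    segInt p q (fun x => F x + G x) = segInt p q F + segInt p q G := by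
  unfold segInt
  rw [intervalIntegral.integral_add (Continuous.intervalIntegrable (by fun_prop) _ _)
    (Continuous.intervalIntegrable (by fun_prop) _ _), mul_add]

lemma segInt_const_mul (p q : Pt) (r : ℝ) (F : Pt → ℝ) :
    segInt p q (fun x => r * F x) = r * segInt p q F := by
  unfold segInt
  rw [intervalIntegral.integral_const_mul]
  ring

lemma segInt_neg (p q : Pt) (F : Pt → ℝ) :
    segInt p q (fun x => -F x) = -segInt p q F := by
  simpa using segInt_const_mul p q (-1) F

lemma segInt_sub (p q : Pt) {F G : Pt → ℝ} (hF : Continuous F) (hG : Continuous G) :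
    segInt p q (fun x => F x - G x) = segInt p q F - segInt p q G := by
  simp only [sub_eq_add_neg]
  rw [segInt_add p q hF (by fun_prop), segInt_neg]

lemma segInt_nonneg (p q : Pt) {F : Pt → ℝ} (hF : ∀ x, 0 ≤ F x) : 0 ≤ segInt p q F :=
  mul_nonneg dist_nonneg (intervalIntegral.integral_nonneg zero_le_one fun _ _ => hF _)

@[simp] lemma segInt_zero (p q : Pt) : segInt p q (fun _ => 0) = 0 := by simp [segInt]

lemma eq_zero_of_segInt_sq_eq_zero {p q : Pt} (hpq : p ≠ q) {F : Pt → ℝ} (hF : Continuous F)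
    (h : segInt p q (fun x => F x ^ 2) = 0) : ∀ s ∈ Set.Icc (0 : ℝ) 1, F (segPt p q s) = 0 := by
  by_contra! hne
  obtain ⟨s, hs, hs0⟩ := hne
  have hpos : 0 < ∫ s in (0 : ℝ)..1, F (segPt p q s) ^ 2 :=
    intervalIntegral.integral_pos zero_lt_one (Continuous.continuousOn (by fun_prop))
      (fun _ _ => sq_nonneg _) ⟨s, hs, by positivity⟩
  exact (mul_pos (dist_pos.2 hpq) hpos).ne' h

@[fun_prop] lemma continuous_evV (v : Fin 2 → Poly) : Continuous (evV v) :=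
  continuous_pi fun i => continuous_ev (v i)

@[fun_prop] lemma continuous_dotProduct_const {v : Pt → Vec} (hv : Continuous v) (w : Vec) :
    Continuous fun x => v x ⬝ᵥ w := hv.dotProduct continuous_const

/-! ### Polynomial identities -/

lemma ev_divV_mul (q : Poly) (v : Fin 2 → Poly) (x : Pt) :
    ev (divV fun i => q * v i) x = ev q x * ev (divV v) x + evV v x ⬝ᵥ evV (grad q) x := by
  simp only [divV, grad, evV, dotProduct, Fin.sum_univ_two, Derivation.leibniz, smul_eq_mul,
    ev_add, ev_mul]
  ring

lemma evV_mul (q : Poly) (v : Fin 2 → Poly) (x : Pt) :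
    evV (fun i => q * v i) x = ev q x • evV v x := by
  ext i
  simp [evV]

lemma evV_grad_mul_self (q : Poly) (x : Pt) :
    evV (grad (q * q)) x = (2 * ev q x) • evV (grad q) x := by
  ext i
  simp only [grad, evV, Derivation.leibniz, smul_eq_mul, ev_add, ev_mul, Pi.smul_apply]
  ring

/-- Truncated subtraction does no harm: a monomial either lacks the variable and is killed, or has
positive degree. -/
lemma totalDegree_pderiv_le {k : ℕ} {p : Poly} (hp : p.totalDegree ≤ k) (i : Fin 2) :
    (MvPolynomial.pderiv i p).totalDegree ≤ k - 1 := by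
  rw [p.as_sum, map_sum]
  refine MvPolynomial.totalDegree_finsetSum_le fun m hm => ?_
  rw [MvPolynomial.pderiv_monomial]
  rcases Nat.eq_zero_or_pos (m i) with h0 | h0
  · simp [h0]
  · refine (MvPolynomial.totalDegree_monomial_le _ _).trans ?_
    have h1 := (MvPolynomial.le_totalDegree hm).trans hp
    have h2 : m - Finsupp.single i 1 + Finsupp.single i 1 = m :=
      tsub_add_cancel_of_le (by simpa [Nat.one_le_iff_ne_zero] using h0.ne')
    rw [← h2, Finsupp.sum_add_index' (fun _ => rfl) (fun _ _ _ => rfl),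
      Finsupp.sum_single_index rfl] at h1
    exact Nat.le_sub_of_add_le h1

lemma totalDegree_divV_le {k : ℕ} {v : Fin 2 → Poly} (hv : ∀ i, (v i).totalDegree ≤ k) :
    (divV v).totalDegree ≤ k - 1 :=
  MvPolynomial.totalDegree_finsetSum_le fun i _ => totalDegree_pderiv_le (hv i) i

/-! ### Vanishing on a triangle -/

/-- The linear polynomial that vanishes on the line through `p` and `q`. -/
noncomputable def linePoly (p q : Pt) : Poly :=
  MvPolynomial.C (q 0 - p 0) * (MvPolynomial.X 1 - MvPolynomial.C (p 1))
    - MvPolynomial.C (q 1 - p 1) * (MvPolynomial.X 0 - MvPolynomial.C (p 0))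

lemma ev_linePoly (p q x : Pt) : ev (linePoly p q) x = det3 p q x := by
  simp [linePoly, det3]

lemma totalDegree_linePoly (p q : Pt) : (linePoly p q).totalDegree ≤ 1 := by
  have h : ∀ (r s : ℝ) (i : Fin 2), (MvPolynomial.C r * (MvPolynomial.X i - MvPolynomial.C s) :
      Poly).totalDegree ≤ 1 := by
    intro r s i
    refine (MvPolynomial.totalDegree_mul _ _).trans ?_
    rw [MvPolynomial.totalDegree_C, zero_add]
    refine (MvPolynomial.totalDegree_sub _ _).trans ?_
    simp
  exact (MvPolynomial.totalDegree_sub _ _).trans (max_le (h _ _ _) (h _ _ _))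

lemma ev_linePoly_segPt (p q : Pt) (s : ℝ) : ev (linePoly p q) (segPt p q s) = 0 := by
  rw [ev_linePoly, segPt_eq]
  simp [det3]
  ring

lemma det3_nonneg_of_mem {p q r x : Pt} (hD : 0 < det3 p q r)
    (hx : x ∈ convexHull ℝ ({p, q, r} : Set Pt)) : 0 ≤ det3 p q x := by
  obtain ⟨⟨y, z⟩, ⟨_, hz, _⟩, rfl⟩ := (mem_convexHull_triple p q r x).1 hx
  have : det3 p q (p + y • (q - p) + z • (r - p)) = z * det3 p q r := by
    simp [det3]
    ring
  rw [this]
  exact mul_nonneg hz hD.le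

/-- The exceptional set is an affine subspace, proper because it misses `r`, hence a null set. -/
lemma ae_det3_ne_zero {p q r : Pt} (hD : 0 < det3 p q r) : ∀ᵐ x : Pt, det3 p q x ≠ 0 := by
  let f : Pt →ₗ[ℝ] ℝ := ((q 0 - p 0) • (EuclideanSpace.proj 1 : Pt →L[ℝ] ℝ)
    - (q 1 - p 1) • (EuclideanSpace.proj 0 : Pt →L[ℝ] ℝ)).toLinearMap
  have hf : ∀ x, f (x - p) = det3 p q x := by
    intro x
    simp [f, det3]
  have h0 : volume (AffineSubspace.mk' p (LinearMap.ker f) : Set Pt) = 0 := by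
    refine Measure.addHaar_affineSubspace volume _ fun htop => ?_
    have : r ∈ AffineSubspace.mk' p (LinearMap.ker f) := by rw [htop]; trivial
    rw [AffineSubspace.mem_mk', LinearMap.mem_ker, vsub_eq_sub, hf] at this
    exact hD.ne' this
  rw [ae_iff]
  convert h0 using 2
  ext x
  simp [AffineSubspace.mem_mk', LinearMap.mem_ker, hf]

lemma isCompact_triangle (p q r : Pt) : IsCompact (convexHull ℝ ({p, q, r} : Set Pt)) :=
  (Set.toFinite _).isCompact_convexHull (𝕜 := ℝ)

/-- On the triangle the linear weight is nonnegative and vanishes only on a null set, so it does not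
weaken the conclusion drawn from an integral of a square. -/
lemma ae_eq_zero_of_integral_line_mul_sq {p q r : Pt} (hD : 0 < det3 p q r) {F : Pt → ℝ}
    (hF : Continuous F)
    (h : ∫ x in convexHull ℝ ({p, q, r} : Set Pt), ev (linePoly p q) x * F x ^ 2 = 0) :
    ∀ᵐ x ∂volume.restrict (convexHull ℝ ({p, q, r} : Set Pt)), F x = 0 := by
  have hc := isCompact_triangle p q r
  have h0 : 0 ≤ᵐ[volume.restrict (convexHull ℝ ({p, q, r} : Set Pt))]
      fun x => ev (linePoly p q) x * F x ^ 2 := by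
    filter_upwards [ae_restrict_mem hc.measurableSet] with x hx
    rw [ev_linePoly]
    exact mul_nonneg (det3_nonneg_of_mem hD hx) (sq_nonneg _)
  rw [integral_eq_zero_iff_of_nonneg_ae h0
    (Continuous.continuousOn (by fun_prop) |>.integrableOn_compact hc)] at h
  filter_upwards [h, ae_restrict_of_ae (ae_det3_ne_zero hD)] with x hx hx'
  rw [ev_linePoly] at hx
  exact pow_eq_zero_iff two_ne_zero |>.1 ((mul_eq_zero.1 hx).resolve_left hx')

lemma ae_eq_zero_of_integral_sq {S : Set Pt} (hS : IsCompact S) {F : Pt → ℝ}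
    (hF : Continuous F) (h : ∫ x in S, F x ^ 2 = 0) :
    ∀ᵐ x ∂volume.restrict S, F x = 0 := by
  rw [integral_eq_zero_iff_of_nonneg_ae (Filter.Eventually.of_forall fun x => sq_nonneg _)
    (Continuous.continuousOn (by fun_prop) |>.integrableOn_compact hS)] at h
  filter_upwards [h] with x hx
  exact pow_eq_zero_iff two_ne_zero |>.1 hx

/-! ### Piecewise polynomials on the mesh. -/

namespace Mesh

variable {M : Mesh}

@[fun_prop] lemma continuous_fn (q : M.Sca) (t : M.T) : Continuous (fn q t) := continuous_ev _

@[fun_prop] lemma continuous_fnV (v : M.VecF) (t : M.T) : Continuous (fnV v t) := continuous_evV _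

lemma isCompact_tri (t : M.T) : IsCompact (M.tri t) := isCompact_triangle _ _ _

lemma integrableOn_tri {F : Pt → ℝ} (hF : Continuous F) (t : M.T) : IntegrableOn F (M.tri t) :=
  hF.continuousOn.integrableOn_compact (isCompact_tri t)

lemma a_ne_b (t : M.T) : M.a t ≠ M.b t := by
  intro h
  have := M.orient t
  simp [h] at this

/-- The triangle that precedes `t` in its primal element. -/
def prev (t : M.T) : M.T := M.next.symm t

lemma next_prev (t : M.T) : M.next (prev t) = t := M.next.apply_symm_apply t

lemma prev_next (t : M.T) : prev (M.next t) = t := M.next.symm_apply_apply t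

lemma b_prev (t : M.T) : M.b (prev t) = M.a t := by
  rw [← M.a_next, next_prev]

lemma ν_prev (t : M.T) : M.ν (prev t) = M.ν t := by
  rw [← M.ν_next, next_prev]

/-! ### Elementwise integration by parts -/

/-- The third side of `t` is the dual edge of `prev t`, whose fixed normal points into `t`; hence
the minus sign. -/
lemma integral_div_tri (t : M.T) (v : Fin 2 → Poly) :
    ∫ x in M.tri t, ev (divV v) x = M.intPr t (fun x => evV v x ⬝ᵥ M.nPr t)
      + M.intDl t (fun x => evV v x ⬝ᵥ M.nDl t)
      - M.intDl (prev t) (fun x => evV v x ⬝ᵥ M.nDl (prev t)) := by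
  have h := setIntegral_div_triangle (M.a t) (M.b t) (M.ν t) (M.orient t) v
  have h2 : segInt (M.ν t) (M.a t) (fun x => evV v x ⬝ᵥ nrm (M.ν t) (M.a t)) =
      -segInt (M.a t) (M.ν t) (fun x => evV v x ⬝ᵥ nrm (M.a t) (M.ν t)) := by
    rw [nrm_symm, segInt_symm, ← segInt_neg]
    simp only [dotProduct_neg]
  rw [h2] at h
  simp only [intPr, intDl, nPr, nDl, b_prev, ν_prev, tri]
  rw [h]
  ring

/-- Moves the contribution of each dual edge from the triangle behind it to the one that indexes the
edge, so that both sides can be joined into a jump. -/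
lemma sum_prev (S : Finset M.T) (hS : ∀ t, M.next t ∈ S ↔ t ∈ S) (F : M.T → M.T → ℝ) :
    ∑ t ∈ S, F t (prev t) = ∑ t ∈ S, F (M.next t) t := by
  refine (Finset.sum_bij (fun t _ => M.next t) (fun t ht => (hS t).2 ht)
    (fun _ _ _ _ h => M.next.injective h)
    (fun t ht => ⟨prev t, (hS _).1 (by rwa [next_prev]), next_prev t⟩) fun t _ => ?_).symm
  rw [prev_next]

/-- Integration by parts on a union of primal elements, for a field with continuous normal
components over the dual edges. -/
lemma sum_integral_by_parts (S : Finset M.T) (hS : ∀ t, M.next t ∈ S ↔ t ∈ S)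
    (q : M.Sca) (v : M.VecF)
    (hv : ∀ t ∈ S, ∀ s ∈ Set.Icc (0 : ℝ) 1, M.jumpDl (fnV v) t (M.ptDl t s) ⬝ᵥ M.nDl t = 0) :
    (∑ t ∈ S, ∫ x in M.tri t, fn q t x * ev (divV (v t)) x)
      + (∑ t ∈ S, ∫ x in M.tri t, fnV v t x ⬝ᵥ evV (grad (q t)) x)
      = (∑ t ∈ S, M.intPr t fun x => fn q t x * (fnV v t x ⬝ᵥ M.nPr t))
        + ∑ t ∈ S, M.intDl t fun x => (fnV v t x ⬝ᵥ M.nDl t) * M.jumpDl (fn q) t x := by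
  have h1 : ∀ t, (∫ x in M.tri t, fn q t x * ev (divV (v t)) x)
      + (∫ x in M.tri t, fnV v t x ⬝ᵥ evV (grad (q t)) x) =
      (M.intPr t fun x => fn q t x * (fnV v t x ⬝ᵥ M.nPr t))
      + (M.intDl t fun x => fn q t x * (fnV v t x ⬝ᵥ M.nDl t))
      - M.intDl (prev t) fun x => fn q t x * (fnV v t x ⬝ᵥ M.nDl (prev t)) := by
    intro t
    -- The divergence theorem for the product `q v`.
    have := integral_div_tri t (fun i => q t * v t i)
    simp only [ev_divV_mul, evV_mul, smul_dotProduct, smul_eq_mul] at this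
    rw [← integral_add (integrableOn_tri (by fun_prop) t)
      (integrableOn_tri ((continuous_fnV v t).dotProduct (continuous_evV _)) t)]
    exact this
  rw [← Finset.sum_add_distrib]
  simp only [h1]
  rw [Finset.sum_sub_distrib, Finset.sum_add_distrib,
    sum_prev S hS (fun t r => M.intDl r fun x => fn q t x * (fnV v t x ⬝ᵥ M.nDl r)),
    add_sub_assoc, ← Finset.sum_sub_distrib]
  congr 1
  refine Finset.sum_congr rfl fun t ht => ?_
  rw [intDl, intDl, ← segInt_sub _ _ (by fun_prop) (by fun_prop)]
  refine segInt_congr fun s hs => ?_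
  -- Normal continuity allows the trace of `v` from `next t` to be replaced by that from `t`,
  -- leaving the jump of `q` alone.
  have := hv t ht s hs
  simp only [jumpDl, sub_dotProduct, ptDl] at this ⊢
  linear_combination fn q (M.next t) (segPt (M.b t) (M.ν t) s) * this

lemma next_mem_filter_reg (r : Region) (t : M.T) :
    M.next t ∈ Finset.univ.filter (fun t => M.reg t = r) ↔
      t ∈ Finset.univ.filter (fun t => M.reg t = r) := by
  simp [M.reg_next]

/-! ### Primal edges seen from both sides -/

lemma intPr_twin {t : M.T} (ht : M.twin t ≠ t) (F : Pt → ℝ) :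
    M.intPr (M.twin t) F = M.intPr t F := by
  rw [intPr, intPr, (M.twin_edge t ht).1, (M.twin_edge t ht).2, segInt_symm]

lemma nPr_twin {t : M.T} (ht : M.twin t ≠ t) : M.nPr (M.twin t) = -M.nPr t := by
  rw [nPr, nPr, (M.twin_edge t ht).1, (M.twin_edge t ht).2, nrm_symm]

lemma ptPr_twin {t : M.T} (ht : M.twin t ≠ t) (s : ℝ) :
    M.ptPr (M.twin t) (1 - s) = M.ptPr t s := by
  rw [ptPr, ptPr, (M.twin_edge t ht).1, (M.twin_edge t ht).2, segPt_symm]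

lemma twin_twin_ne {t : M.T} (ht : M.twin t ≠ t) : M.twin (M.twin t) ≠ M.twin t := by
  rw [M.twin_twin]
  exact ht.symm

lemma twin_injective : Function.Injective M.twin :=
  (show Function.Involutive M.twin from M.twin_twin).injective

/-- `q` is single-valued on the interior primal edges. -/
def SingleValued (q : M.Sca) : Prop :=
  ∀ t, ∀ s ∈ Set.Icc (0 : ℝ) 1, fn q (M.twin t) (M.ptPr t s) = fn q t (M.ptPr t s)

/-- The normal component of `v` is continuous over the interior primal edges. -/
def NormalContinuous (v : M.VecF) : Prop :=
  ∀ t, ∀ s ∈ Set.Icc (0 : ℝ) 1,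
    fnV v (M.twin t) (M.ptPr t s) ⬝ᵥ M.nPr t = fnV v t (M.ptPr t s) ⬝ᵥ M.nPr t

/-- The space `U_h` imposes continuity from the leading side only. The other side traverses the edge
backwards, which replaces `s` by `1 - s`. -/
lemma IsU.singleValued {k : ℕ} {q : M.Sca} (hq : IsU k q) : SingleValued q := by
  have key : ∀ t ∈ M.lead, M.twin t ≠ t → ∀ s ∈ Set.Icc (0 : ℝ) 1,
      fn q (M.twin t) (M.ptPr t s) = fn q t (M.ptPr t s) := by
    intro t ht htw s hs
    have := hq.2 t ht htw s hs
    rw [jumpPr, if_neg htw] at this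
    linarith
  intro t s hs
  by_cases htw : M.twin t = t
  · rw [htw]
  by_cases ht : t ∈ M.lead
  · exact key t ht htw s hs
  · have h1 : M.twin t ∈ M.lead := by
      by_contra h
      exact ht ((M.lead_interior t htw).2 h)
    have := key _ h1 (twin_twin_ne htw) (1 - s) ⟨by linarith [hs.2], by linarith [hs.1]⟩
    rw [M.twin_twin, ptPr_twin htw] at this
    exact this.symm

/-- Over the primal edges, leading sides collect the jumps. -/
lemma sum_lead_jumpPr {c : M.Sca} (hc : SingleValued c) (ψ : M.VecF) :
    ∑ t ∈ M.lead, M.intPr t (fun x => fn c t x * (M.jumpPr (fnV ψ) t x ⬝ᵥ M.nPr t)) =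
      ∑ t, M.intPr t fun x => fn c t x * (fnV ψ t x ⬝ᵥ M.nPr t) := by
  set H : M.T → ℝ := fun t => M.intPr t fun x => fn c t x * (fnV ψ t x ⬝ᵥ M.nPr t) with hH
  -- The subtracted trace in the jump is the twin's own outward contribution, since the twin has the
  -- opposite normal.
  have h1 : ∀ t ∈ M.lead, M.intPr t (fun x => fn c t x * (M.jumpPr (fnV ψ) t x ⬝ᵥ M.nPr t)) =
      H t + if M.twin t ≠ t then H (M.twin t) else 0 := by
    intro t _
    by_cases htw : M.twin t = t
    · simp [jumpPr, htw, hH]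
    · simp only [jumpPr, htw, if_false, hH, ne_eq, not_false_eq_true, if_true]
      rw [intPr_twin htw, nPr_twin htw, intPr, intPr, intPr,
        ← segInt_add _ _ (by fun_prop) (by fun_prop)]
      refine segInt_congr fun s hs => ?_
      have := hc t s hs
      rw [ptPr] at this
      rw [this, sub_dotProduct, dotProduct_neg]
      ring
  -- `twin` maps the interior leading triangles bijectively onto the complement of `lead`, so the
  -- two sums together run over all triangles.
  rw [Finset.sum_congr rfl h1, Finset.sum_add_distrib,
    ← Finset.sum_add_sum_compl M.lead H]
  congr 1
  rw [← Finset.sum_filter]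
  refine Finset.sum_bij (fun t _ => M.twin t) (fun t ht => ?_)
    (fun _ _ _ _ h => twin_injective h) (fun t ht => ?_) fun _ _ => rfl
  · rw [Finset.mem_filter] at ht
    rw [Finset.mem_compl]
    exact (M.lead_interior t ht.2).1 ht.1
  · rw [Finset.mem_compl] at ht
    have htw : M.twin t ≠ t := fun h => ht (M.lead_boundary t h)
    refine ⟨M.twin t, Finset.mem_filter.2 ⟨?_, twin_twin_ne htw⟩, M.twin_twin t⟩
    by_contra h
    exact ht ((M.lead_interior t htw).2 h)

/-- A sum over a set of interior primal edges, symmetrised over the two sides. -/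
lemma two_mul_sum_twin (S : Finset M.T) (hS : ∀ t ∈ S, M.twin t ∈ S) (F : M.T → ℝ) :
    2 * ∑ t ∈ S, F t = ∑ t ∈ S, (F t + F (M.twin t)) := by
  have : ∑ t ∈ S, F (M.twin t) = ∑ t ∈ S, F t :=
    Finset.sum_bij (fun t _ => M.twin t) hS (fun _ _ _ _ h => twin_injective h)
      (fun t ht => ⟨M.twin t, hS t ht, M.twin_twin t⟩) fun _ _ => rfl
  rw [Finset.sum_add_distrib, this]
  ring

/-- Interior primal edges do not contribute to the total flux of a field with continuous normal
components. -/
lemma sum_flux_eq_zero (S : Finset M.T) (hS : ∀ t ∈ S, M.twin t ∈ S)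
    (hS' : ∀ t ∈ S, M.twin t ≠ t) (q : M.Sca) (v : M.VecF)
    (hq : ∀ t ∈ S, ∀ s ∈ Set.Icc (0 : ℝ) 1,
      fn q (M.twin t) (M.ptPr t s) = fn q t (M.ptPr t s))
    (hv : ∀ t ∈ S, ∀ s ∈ Set.Icc (0 : ℝ) 1,
      fnV v (M.twin t) (M.ptPr t s) ⬝ᵥ M.nPr t = fnV v t (M.ptPr t s) ⬝ᵥ M.nPr t) :
    ∑ t ∈ S, M.intPr t (fun x => fn q t x * (fnV v t x ⬝ᵥ M.nPr t)) = 0 := by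
  -- Seen from the twin, the same edge carries the same flux with opposite sign.
  have h := two_mul_sum_twin S hS fun t => M.intPr t fun x => fn q t x * (fnV v t x ⬝ᵥ M.nPr t)
  have h0 := h.trans (Finset.sum_eq_zero fun t ht => ?_)
  · linarith
  · have htw := hS' t ht
    rw [intPr_twin htw, nPr_twin htw, intPr, intPr, ← segInt_add _ _ (by fun_prop) (by fun_prop)]
    rw [← segInt_zero (M.a t) (M.b t)]
    refine segInt_congr fun s hs => ?_
    have h1 := hq t ht s hs
    have h2 := hv t ht s hs
    rw [ptPr] at h1 h2
    rw [h1, dotProduct_neg, h2]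
    ring

/-! ### Identities for the transport forms. -/

/-- The forms `T_h` and `T_h^*` are adjoint to each other. -/
lemma formT_eq_formTstar {k : ℕ} {z : M.VecF} {q : M.Sca} (hz : IsW k z) (hq : IsU k q) :
    formT z q = formTstar q z := by
  have h := sum_integral_by_parts Finset.univ (by simp) q z fun t _ => (hz t).2
  rw [formT, formTstar, intAll, intAll, sum_lead_jumpPr hq.singleValued]
  linarith

/-- The upwind form tested with its own argument. -/
lemma convection_identity {c : M.Sca} {v : M.VecF}
    (hv : ∀ t, ∀ s ∈ Set.Icc (0 : ℝ) 1, M.jumpDl (fnV v) t (M.ptDl t s) ⬝ᵥ M.nDl t = 0) :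
    -(M.intAll fun t x => (fn c t x • fnV v t x) ⬝ᵥ evV (grad (c t)) x) + formS v c c =
      (1 / 2) * (∑ t, ∫ x in M.tri t, fn c t x ^ 2 * ev (divV (v t)) x)
      - (1 / 2) * (∑ t, M.intPr t fun x => fn c t x ^ 2 * (fnV v t x ⬝ᵥ M.nPr t))
      + (1 / 2) * ∑ t, M.intDl t fun x => M.jumpDl (fn c) t x ^ 2 * |fnV v t x ⬝ᵥ M.nDl t| := by
  -- Integration by parts with `c²`: in the interior `c ∇c = ½ ∇(c²)`, and on dual edges `{c}[c] = ½
  -- [c²]`, so the centred flux cancels and only the upwind penalty survives there.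
  have h := sum_integral_by_parts Finset.univ (by simp) (fun t => c t * c t) v fun t _ => hv t
  have e1 : ∀ t x, fn (fun t => c t * c t) t x = fn c t x ^ 2 := by
    intro t x
    simp [fn, sq]
  have e2 : ∀ t, ∫ x in M.tri t, fnV v t x ⬝ᵥ evV (grad (c t * c t)) x =
      2 * ∫ x in M.tri t, (fn c t x • fnV v t x) ⬝ᵥ evV (grad (c t)) x := by
    intro t
    rw [← integral_const_mul]
    congr 1
    ext x
    rw [evV_grad_mul_self, dotProduct_smul, smul_dotProduct, smul_eq_mul, smul_eq_mul, mul_assoc]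
    rfl
  have e3 : ∀ t, (M.intDl t fun x => (fnV v t x ⬝ᵥ M.nDl t) * M.jumpDl (fn fun t => c t * c t) t x)
      = 2 * M.intDl t fun x =>
        M.avgDl (fn c) t x * M.jumpDl (fn c) t x * (fnV v t x ⬝ᵥ M.nDl t) := by
    intro t
    rw [intDl, intDl, ← segInt_const_mul]
    congr 1
    ext x
    simp only [jumpDl, avgDl, e1]
    ring
  simp only [e1, e2, e3, ← Finset.mul_sum] at h
  rw [formS, intAll]
  simp only [← sq]
  linarith

/-! ### Consequences of the discrete flow equations -/

lemma isQD_sub_div {k : ℕ} {f : M.Sca} (hf : IsQD k f) {uh : M.VecF} (hu : IsHD k uh) :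
    IsQD k (fun t => f t - divV (uh t)) := fun t ht =>
  (MvPolynomial.totalDegree_sub _ _).trans
    (max_le (hf t ht) (totalDegree_divV_le (hu.1 t ht).1))

/-- The second flow equation combines momentum in `Ω_B` with mass conservation in `Ω_D`; the test
function `v_B = 0` isolates the latter. -/
lemma formA_eq_of_mass {k : ℕ} {ε : ℝ} {α : Matrix (Fin 2) (Fin 2) ℝ}
    {KD : Pt → Matrix (Fin 2) (Fin 2) ℝ} {fB fD : Pt → Vec} {f : M.Sca} {g₁ g₂ : Pt → ℝ}
    {L : M.MatF} {uh : M.VecF} {pB pD : M.Sca}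
    (h : IsFlowSolution k ε α KD fB fD f g₁ g₂ L uh pB pD) {q : M.Sca} (hq : IsQD k q) :
    formA uh q = M.intReg Region.D fun t x => fn f t x * fn q t x := by
  have hz : IsHB k (0 : M.VecF) := fun t _ => by
    refine ⟨fun i => by simp, fun s _ => ?_⟩
    simp [jumpDl, fnV, evV, dotProduct]
  have h0 : ∀ t x, fnV (0 : M.VecF) t x = 0 := fun t x => by ext i; simp [fnV, evV]
  have h1 : ∀ x i j, evM (gradV (0 : Fin 2 → Poly)) x i j = 0 := fun x i j => by
    simp [evM, gradV]
  have h2 : ∀ x, ev (divV (0 : Fin 2 → Poly)) x = 0 := fun x => by simp [divV]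
  have := h.2.2.2.2.2.2.1 0 q hz hq
  simpa [formB, formbstar, jumpPr, jumpDl, h0, h1, h2, intReg, intPr, intDl] using this

/-- On `Ω_D` the divergence of the discrete velocity is `f`. -/
lemma ae_div_eq_of_D {k : ℕ} {f : M.Sca} (hf : IsQD k f) {uh : M.VecF} (hu : IsHD k uh)
    (hA : ∀ q : M.Sca, IsQD k q →
      formA uh q = M.intReg Region.D fun t x => fn f t x * fn q t x)
    {t : M.T} (ht : M.reg t = Region.D) :
    ∀ᵐ x ∂volume.restrict (M.tri t), ev (divV (uh t)) x = fn f t x := by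
  -- Tested with the residual `f - div u_h` itself, the equation says that its squared norm
  -- vanishes.
  have h := hA _ (isQD_sub_div hf hu)
  rw [formA, eq_comm, ← sub_eq_zero, intReg, intReg, ← Finset.sum_sub_distrib] at h
  have e : ∀ t, (∫ x in M.tri t, fn f t x * fn (fun t => f t - divV (uh t)) t x)
      - (∫ x in M.tri t, fn (fun t => f t - divV (uh t)) t x * ev (divV (uh t)) x) =
      ∫ x in M.tri t, (fn f t x - ev (divV (uh t)) x) ^ 2 := by
    intro t
    rw [← integral_sub (integrableOn_tri (by fun_prop) t) (integrableOn_tri (by fun_prop) t)]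
    congr 1
    ext x
    simp only [fn, ev_sub]
    ring
  simp only [e] at h
  rw [Finset.sum_eq_zero_iff_of_nonneg fun t _ => integral_nonneg fun x => sq_nonneg _] at h
  filter_upwards [ae_eq_zero_of_integral_sq (isCompact_tri t) (by fun_prop)
    (h t (by simp [ht]))] with x hx
  linarith

lemma IsHD.normal_continuous {k : ℕ} {v : M.VecF} (hv : IsHD k v) {t : M.T}
    (htw : M.twin t ≠ t) (ht : M.reg t = Region.D) (ht' : M.reg (M.twin t) = Region.D)
    {s : ℝ} (hs : s ∈ Set.Icc (0 : ℝ) 1) :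
    fnV v (M.twin t) (M.ptPr t s) ⬝ᵥ M.nPr t = fnV v t (M.ptPr t s) ⬝ᵥ M.nPr t := by
  by_cases hl : t ∈ M.lead
  · have := hv.2 t (by simp [prInt, hl, htw, ht, ht']) s hs
    rw [jumpPr, if_neg htw, sub_dotProduct] at this
    linarith
  · have h1 : M.twin t ∈ M.lead := by
      by_contra h
      exact hl ((M.lead_interior t htw).2 h)
    have := hv.2 (M.twin t) (by simp [prInt, h1, htw.symm, ht, ht', M.twin_twin]) (1 - s)
      ⟨by linarith [hs.2], by linarith [hs.1]⟩
    rw [jumpPr, if_neg (twin_twin_ne htw), sub_dotProduct, M.twin_twin, ptPr_twin htw,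
      nPr_twin htw, dotProduct_neg, dotProduct_neg] at this
    linarith

lemma intervalIntegrable_mul_of_memLp {t : M.T} {g : Pt → ℝ}
    (hg : MemLp (fun σ => g (M.ptPr t σ)) 2 (volume.restrict (Set.Icc (0 : ℝ) 1)))
    {F : Pt → ℝ} (hF : Continuous F) :
    IntervalIntegrable (fun σ => g (M.ptPr t σ) * F (M.ptPr t σ)) volume 0 1 := by
  have h1 : IntegrableOn (fun σ => g (M.ptPr t σ)) (Set.Icc (0 : ℝ) 1) :=
    hg.integrable one_le_two
  have h2 : IntervalIntegrable (fun σ => g (M.ptPr t σ)) volume 0 1 := by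
    rwa [intervalIntegrable_iff_integrableOn_Icc_of_le zero_le_one]
  exact h2.mul_continuousOn (Continuous.continuousOn (hF.comp (continuous_segPt _ _)))

lemma intPr_sub_of_memLp {t : M.T} {g : Pt → ℝ}
    (hg : MemLp (fun σ => g (M.ptPr t σ)) 2 (volume.restrict (Set.Icc (0 : ℝ) 1)))
    {F G : Pt → ℝ} (hF : Continuous F) (hG : Continuous G) :
    M.intPr t (fun x => g x * F x - G x) = M.intPr t (fun x => g x * F x) - M.intPr t G := by
  rw [intPr, intPr, intPr, segInt, segInt, segInt, ← mul_sub]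
  congr 1
  exact intervalIntegral.integral_sub (intervalIntegrable_mul_of_memLp hg hF)
    (Continuous.intervalIntegrable (hG.comp (continuous_segPt _ _)) _ _)

/-- The interface transports out of `Ω_D` what enters through `Γ_B`. -/
lemma sum_iface_flux {k : ℕ} {f : M.Sca} {g₁ g₂ : Pt → ℝ} {uh : M.VecF} (hu : IsHDg k g₂ uh)
    (hg₂ : ∀ t ∈ M.bdry Region.D,
      MemLp (fun σ => g₂ (M.ptPr t σ)) 2 (volume.restrict (Set.Icc (0 : ℝ) 1)))
    (hcompat : (∑ t ∈ M.bdry Region.B, M.intPr t g₁) + (∑ t ∈ M.bdry Region.D, M.intPr t g₂)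
      = M.intReg Region.D (fn f))
    (hdiv : ∀ t, M.reg t = Region.D →
      ∀ᵐ x ∂volume.restrict (M.tri t), ev (divV (uh t)) x = fn f t x) :
    (∑ t ∈ M.iface, M.intPr t fun x => fnV uh (M.twin t) x ⬝ᵥ M.nPr t)
      + ∑ t ∈ M.bdry Region.B, M.intPr t g₁ = 0 := by
  -- With `q = 1` this is the divergence theorem on `Ω_D`.
  have h := sum_integral_by_parts (Finset.univ.filter fun t => M.reg t = Region.D)
    (next_mem_filter_reg _) (fun _ => 1) uh fun t ht => (hu.1.1 t (by simpa using ht)).2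
  have e1 : ∀ t x, fn (fun _ : M.T => (1 : Poly)) t x = 1 := fun t x => by simp [fn]
  have e2 : ∀ x, evV (grad (1 : Poly)) x = 0 := fun x => by ext i; simp [evV, grad]
  simp only [e1, e2, jumpDl, sub_self, mul_zero, dotProduct_zero, integral_zero, intDl, segInt_zero,
    Finset.sum_const_zero, add_zero, one_mul] at h
  have h1 : ∑ t with M.reg t = Region.D, ∫ x in M.tri t, ev (divV (uh t)) x
      = M.intReg Region.D (fn f) := by
    refine Finset.sum_congr rfl fun t ht => integral_congr_ae (hdiv t (by simpa using ht))
  -- The edgewise projection preserves the total flux: its defining identity is tested with the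
  -- constant `1`.
  have h2 : ∀ t ∈ M.bdry Region.D, M.intPr t g₂ = M.intPr t fun x => fnV uh t x ⬝ᵥ M.nPr t := by
    intro t ht
    have := hu.2 t ht 1 (by simp)
    simp only [ev_one, mul_one] at this
    have h3 := intPr_sub_of_memLp (hg₂ t ht) (F := fun _ => 1)
      (G := fun x => fnV uh t x ⬝ᵥ M.nPr t) (by fun_prop) (by fun_prop)
    simp only [mul_one] at h3
    linarith
  rw [Finset.sum_congr rfl h2, ← h1, h] at hcompat
  set H : M.T → ℝ := fun t => M.intPr t fun x => fnV uh t x ⬝ᵥ M.nPr t with hH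
  -- Primal edges seen from `Ω_D` lie on `Γ_D`, inside `Ω_D`, or on the interface; the second kind
  -- cancels in pairs.
  have h4 : ∑ t with M.reg t = Region.D, H t = ∑ t ∈ M.bdry Region.D, H t
      + ((∑ t with M.twin t ≠ t ∧ M.reg t = Region.D ∧ M.reg (M.twin t) = Region.D, H t)
      + ∑ t with M.reg t = Region.D ∧ M.reg (M.twin t) = Region.B, H t) := by
    simp only [bdry, Finset.sum_filter]
    rw [← Finset.sum_add_distrib, ← Finset.sum_add_distrib]
    refine Finset.sum_congr rfl fun t _ => ?_
    by_cases htw : M.twin t = t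
    · cases hr : M.reg t <;> simp [htw, hr]
    · cases hr : M.reg t <;> cases hr' : M.reg (M.twin t) <;> simp [htw]
  have h5 : ∑ t with M.twin t ≠ t ∧ M.reg t = Region.D ∧ M.reg (M.twin t) = Region.D, H t = 0 := by
    have := sum_flux_eq_zero
      (Finset.univ.filter fun t => M.twin t ≠ t ∧ M.reg t = Region.D ∧ M.reg (M.twin t) = Region.D)
      (fun t ht => by
        simp only [Finset.mem_filter, Finset.mem_univ, true_and] at ht ⊢
        exact ⟨twin_twin_ne ht.1, ht.2.2, by rw [M.twin_twin]; exact ht.2.1⟩)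
      (fun t ht => by simp only [Finset.mem_filter] at ht; exact ht.2.1) (fun _ => 1) uh
      (fun _ _ _ _ => by simp [fn])
      (fun t ht s hs => by
        simp only [Finset.mem_filter, Finset.mem_univ, true_and] at ht
        exact hu.1.normal_continuous ht.1 ht.2.1 ht.2.2 hs)
    simpa only [e1, one_mul] using this
  have h6 : ∑ t with M.reg t = Region.D ∧ M.reg (M.twin t) = Region.B, H t
      = -∑ t ∈ M.iface, M.intPr t fun x => fnV uh (M.twin t) x ⬝ᵥ M.nPr t := by
    rw [← Finset.sum_neg_distrib]
    refine Finset.sum_bij (fun t _ => M.twin t) (fun t ht => ?_)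
      (fun _ _ _ _ h => twin_injective h) (fun t ht => ⟨M.twin t, ?_, M.twin_twin t⟩)
      fun t ht => ?_
    · simp only [iface, Finset.mem_filter, Finset.mem_univ, true_and] at ht ⊢
      rw [M.twin_twin]
      exact ht.symm
    · simp only [iface, Finset.mem_filter, Finset.mem_univ, true_and] at ht ⊢
      rw [M.twin_twin]
      exact ht.symm
    · simp only [Finset.mem_filter, Finset.mem_univ, true_and] at ht
      have htw : M.twin t ≠ t := by
        intro h
        rw [h, ht.1] at ht
        simp at ht
      rw [intPr_twin htw, nPr_twin htw, M.twin_twin, intPr, ← segInt_neg]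
      simp only [dotProduct_neg, neg_neg, hH, intPr]
  rw [h4, h5, h6] at hcompat
  linarith

lemma formb_sub_const (uh : M.VecF) (q : M.Sca) (m : ℝ) :
    formb uh (fun t => q t - MvPolynomial.C m) = formb uh q := by
  have h1 : ∀ t x, M.jumpDl (fn fun t => q t - MvPolynomial.C m) t x = M.jumpDl (fn q) t x := by
    intro t x
    simp [jumpDl, fn]
  have h2 : ∀ t x, evV (grad (q t - MvPolynomial.C m)) x = evV (grad (q t)) x := by
    intro t x
    ext i
    simp [evV, grad]
  simp only [formb, h1, h2]

/-- Unlike `formb`, which sees only jumps and gradients, the interface form feels constants, through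
the total interface flux. -/
lemma formI_sub_const (uh : M.VecF) (q : M.Sca) (m : ℝ) :
    formI (fun t => q t - MvPolynomial.C m) uh = formI q uh
      + m * ∑ t ∈ M.iface, M.intPr t fun x => fnV uh (M.twin t) x ⬝ᵥ M.nPr t := by
  rw [formI, formI, Finset.mul_sum, ← Finset.sum_add_distrib]
  refine Finset.sum_congr rfl fun t _ => ?_
  rw [intPr, intPr, intPr, ← segInt_const_mul, ← segInt_add _ _ (by fun_prop) (by fun_prop)]
  congr 1
  ext x
  simp only [fn, ev_sub, ev_C, dotProduct_neg]
  ring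

/-- The third flow equation holds for all test functions in `Q_h^B`. -/
lemma continuity_eq_of_isQB {k : ℕ} {g₁ : Pt → ℝ} {uh : M.VecF}
    (hg₁ : ∀ t ∈ M.bdry Region.B,
      MemLp (fun σ => g₁ (M.ptPr t σ)) 2 (volume.restrict (Set.Icc (0 : ℝ) 1)))
    (hiface : (∑ t ∈ M.iface, M.intPr t fun x => fnV uh (M.twin t) x ⬝ᵥ M.nPr t)
      + ∑ t ∈ M.bdry Region.B, M.intPr t g₁ = 0)
    (h : ∀ q : M.Sca, IsQ0 k q → - formI q uh - formb uh q
      = - ∑ t ∈ M.bdry Region.B, M.intPr t fun x => g₁ x * fn q t x)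
    {q : M.Sca} (hq : IsQB k q) :
    - formI q uh - formb uh q = - ∑ t ∈ M.bdry Region.B, M.intPr t fun x => g₁ x * fn q t x := by
  set A : ℝ := M.intReg Region.B fun _ _ => 1 with hA
  -- The mean of `q` over `Ω_B`. If `A = 0`, division by zero gives `m = 0`, which is right because
  -- the integral of `q` vanishes as well.
  set m : ℝ := M.intReg Region.B (fn q) / A with hm
  have hmean : ∀ r : ℝ, M.intReg Region.B (fn fun t => q t - MvPolynomial.C r)
      = M.intReg Region.B (fn q) - r * A := by
    intro r
    rw [hA, intReg, intReg, intReg, Finset.mul_sum, ← Finset.sum_sub_distrib]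
    refine Finset.sum_congr rfl fun t _ => ?_
    rw [← integral_const_mul, ← integral_sub (integrableOn_tri (by fun_prop) t)
      (integrableOn_tri (by fun_prop) t)]
    simp [fn]
  have hA0 : A = 0 → M.intReg Region.B (fn q) = 0 := by
    intro h0
    rw [hA, intReg, Finset.sum_eq_zero_iff_of_nonneg
      fun t _ => integral_nonneg fun x => zero_le_one] at h0
    refine Finset.sum_eq_zero fun t ht => ?_
    have := h0 t ht
    rw [integral_const, smul_eq_mul, mul_one, measureReal_restrict_apply_univ, measureReal_def,
      ENNReal.toReal_eq_zero_iff] at this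
    exact setIntegral_measure_zero _ (this.resolve_right (isCompact_tri t).measure_lt_top.ne)
  have hQ0 : IsQ0 k (fun t => q t - MvPolynomial.C m) := by
    refine ⟨⟨fun t ht => ?_, fun t ht s hs => ?_⟩, ?_⟩
    · exact (MvPolynomial.totalDegree_sub_C_le _ _).trans (hq.1 t ht)
    · have h1 := hq.2 t ht s hs
      have htw : M.twin t ≠ t := by
        simp only [prInt, Finset.mem_filter] at ht
        exact ht.2.1
      rw [jumpPr, if_neg htw] at h1 ⊢
      simpa [fn] using h1
    · rw [hmean, hm]
      by_cases h0 : A = 0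
      · rw [hA0 h0, h0]
        simp
      · field_simp
        simp
  have h1 := h _ hQ0
  rw [formb_sub_const, formI_sub_const] at h1
  have h2 : ∑ t ∈ M.bdry Region.B,
      M.intPr t (fun x => g₁ x * fn (fun t => q t - MvPolynomial.C m) t x)
      = (∑ t ∈ M.bdry Region.B, M.intPr t fun x => g₁ x * fn q t x)
        - m * ∑ t ∈ M.bdry Region.B, M.intPr t g₁ := by
    rw [Finset.mul_sum, ← Finset.sum_sub_distrib]
    refine Finset.sum_congr rfl fun t ht => ?_
    have h3 := intervalIntegrable_mul_of_memLp (hg₁ t ht) (F := fn q t) (by fun_prop)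
    have h4 := intervalIntegrable_mul_of_memLp (hg₁ t ht) (F := fun _ => m) (by fun_prop)
    have h5 := intervalIntegral.integral_sub h3 h4
    simp only [ptPr] at h5
    rw [intPr, intPr, intPr, ← segInt_const_mul, segInt, segInt, segInt, ← mul_sub]
    simp only [mul_comm m]
    rw [← h5]
    simp only [fn, ev_sub, ev_C, mul_sub]
  rw [h2] at h1
  -- The constant contributes `m` times interface flux plus flux through `Γ_B`, and these balance.
  linear_combination h1 + m * hiface

/-- The residual form of the continuity equation, with the derivatives on the velocity. -/
lemma continuity_eq_by_parts {k : ℕ} {g₁ : Pt → ℝ} {uh : M.VecF} (hu : IsHB k uh) {q : M.Sca}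
    (h : - formI q uh - formb uh q
      = - ∑ t ∈ M.bdry Region.B, M.intPr t fun x => g₁ x * fn q t x) :
    (∑ t ∈ M.iface, M.intPr t fun x => fn q t x * (fnV uh (M.twin t) x ⬝ᵥ M.nPr t))
      - (∑ t with M.reg t = Region.B, M.intPr t fun x => fn q t x * (fnV uh t x ⬝ᵥ M.nPr t))
      + (∑ t with M.reg t = Region.B, ∫ x in M.tri t, fn q t x * ev (divV (uh t)) x)
      + (∑ t ∈ M.bdry Region.B, M.intPr t fun x => g₁ x * fn q t x) = 0 := by
  have h1 := sum_integral_by_parts (Finset.univ.filter fun t => M.reg t = Region.B)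
    (next_mem_filter_reg _) q uh fun t ht => (hu t (by simpa using ht)).2
  have h2 : formI q uh
      = -∑ t ∈ M.iface, M.intPr t fun x => fn q t x * (fnV uh (M.twin t) x ⬝ᵥ M.nPr t) := by
    rw [formI, ← Finset.sum_neg_distrib]
    refine Finset.sum_congr rfl fun t _ => ?_
    rw [intPr, intPr, ← segInt_neg]
    congr 1
    ext x
    rw [dotProduct_neg]
    ring
  rw [h2, formb, intReg] at h
  linarith

/-- On `Ω_B` the discrete velocity is divergence free. -/
lemma ae_div_eq_zero_of_B {k : ℕ} (hk : 1 ≤ k) {g₁ : Pt → ℝ} {uh : M.VecF} (hu : IsHB k uh)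
    (h : ∀ q : M.Sca, IsQB k q → - formI q uh - formb uh q
      = - ∑ t ∈ M.bdry Region.B, M.intPr t fun x => g₁ x * fn q t x)
    {t : M.T} (ht : M.reg t = Region.B) :
    ∀ᵐ x ∂volume.restrict (M.tri t), ev (divV (uh t)) x = 0 := by
  -- The linear factor vanishes on the only primal edge of the triangle, which makes `q` continuous
  -- there and removes every edge term. The degree is at most `(k - 1) + 1 = k`, where `1 ≤ k` is
  -- needed.
  set q : M.Sca := fun t => linePoly (M.a t) (M.b t) * divV (uh t) with hq
  have hq0 : ∀ t s, fn q t (segPt (M.a t) (M.b t) s) = 0 := by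
    intro t s
    simp only [fn, hq, ev_mul, ev_linePoly_segPt, zero_mul]
  have hQB : IsQB k q := by
    refine ⟨fun t ht => ?_, fun t ht s _ => ?_⟩
    · refine (MvPolynomial.totalDegree_mul _ _).trans ?_
      have h1 := totalDegree_linePoly (M.a t) (M.b t)
      have h2 := totalDegree_divV_le (hu t ht).1
      omega
    · simp only [prInt, Finset.mem_filter] at ht
      have e1 : fn q t (M.ptPr t s) = 0 := hq0 t s
      have e2 : fn q (M.twin t) (M.ptPr t s) = 0 := by
        rw [← ptPr_twin ht.2.1]
        exact hq0 _ _
      rw [jumpPr, if_neg ht.2.1, e1, e2, sub_zero]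
  have hz : ∀ (t : M.T) (F : Pt → ℝ), M.intPr t (fun x => fn q t x * F x) = 0 := by
    intro t F
    rw [intPr, ← segInt_zero (M.a t) (M.b t)]
    refine segInt_congr fun s _ => ?_
    rw [hq0, zero_mul]
  have h1 := continuity_eq_by_parts hu (h q hQB)
  simp only [mul_comm (g₁ _), hz, Finset.sum_const_zero, sub_zero, zero_add, add_zero] at h1
  have e : ∀ t, ∫ x in M.tri t, fn q t x * ev (divV (uh t)) x
      = ∫ x in M.tri t, ev (linePoly (M.a t) (M.b t)) x * ev (divV (uh t)) x ^ 2 := by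
    intro t
    congr 1
    ext x
    simp only [fn, hq, ev_mul]
    ring
  simp only [e] at h1
  rw [Finset.sum_eq_zero_iff_of_nonneg fun t _ => setIntegral_nonneg
    (isCompact_tri t).measurableSet fun x hx => mul_nonneg (by
      rw [ev_linePoly]; exact det3_nonneg_of_mem (M.orient t) hx) (sq_nonneg _)] at h1
  exact ae_eq_zero_of_integral_line_mul_sq (M.orient t) (by fun_prop) (h1 t (by simp [ht]))

/-- The normal jump of a piecewise polynomial field over the primal edge of `t`, as a polynomial;
zero for boundary edges. -/
noncomputable def normalJump (v : M.VecF) : M.Sca := fun t =>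
  if M.twin t = t then 0
  else ∑ i, MvPolynomial.C (M.nPr t i) * (v t i - v (M.twin t) i)

lemma fn_normalJump (v : M.VecF) {t : M.T} (htw : M.twin t ≠ t) (x : Pt) :
    fn (normalJump v) t x = fnV v t x ⬝ᵥ M.nPr t - fnV v (M.twin t) x ⬝ᵥ M.nPr t := by
  simp only [fn, normalJump, if_neg htw, fnV, evV, dotProduct, Fin.sum_univ_two, ev_add, ev_mul,
    ev_C, ev_sub]
  ring

lemma fn_normalJump_boundary (v : M.VecF) {t : M.T} (htw : M.twin t = t) (x : Pt) :
    fn (normalJump v) t x = 0 := by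
  simp [fn, normalJump, htw]

/-- Exchanging the sides reverses both the difference and the normal, so both triangles carry the
same polynomial. -/
lemma fn_normalJump_twin (v : M.VecF) {t : M.T} (htw : M.twin t ≠ t) (x : Pt) :
    fn (normalJump v) (M.twin t) x = fn (normalJump v) t x := by
  rw [fn_normalJump v htw, fn_normalJump v (twin_twin_ne htw), M.twin_twin, nPr_twin htw,
    dotProduct_neg, dotProduct_neg]
  ring

/-- The discrete velocity has continuous normal components over all interior primal edges. -/
lemma normalContinuous_of_flow {k : ℕ} {g₁ : Pt → ℝ} {uh : M.VecF}
    (hu : IsHB k uh) (huD : IsHD k uh)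
    (hdiv : ∀ t, M.reg t = Region.B →
      ∀ᵐ x ∂volume.restrict (M.tri t), ev (divV (uh t)) x = 0)
    (h : ∀ q : M.Sca, IsQB k q → - formI q uh - formb uh q
      = - ∑ t ∈ M.bdry Region.B, M.intPr t fun x => g₁ x * fn q t x) :
    NormalContinuous uh := by
  have hdeg : ∀ t i, (uh t i).totalDegree ≤ k := by
    intro t i
    cases hr : M.reg t
    · exact (hu t hr).1 i
    · exact (huD.1 t hr).1 i
  -- Admissible because a triangle has no second primal edge on which continuity could fail. It is
  -- zero on triangles at `∂Ω`, so `g₁` drops out.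
  set q := normalJump uh with hq
  have hQB : IsQB k q := by
    refine ⟨fun t _ => ?_, fun t ht s _ => ?_⟩
    · simp only [hq, normalJump]
      split_ifs
      · simp
      · refine MvPolynomial.totalDegree_finsetSum_le fun i _ => ?_
        refine (MvPolynomial.totalDegree_mul _ _).trans ?_
        rw [MvPolynomial.totalDegree_C, zero_add]
        exact (MvPolynomial.totalDegree_sub _ _).trans (max_le (hdeg _ _) (hdeg _ _))
    · simp only [prInt, Finset.mem_filter] at ht
      rw [jumpPr, if_neg ht.2.1, hq, fn_normalJump_twin _ ht.2.1, sub_self]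
  have h1 := continuity_eq_by_parts hu (h q hQB)
  have hb : ∑ t ∈ M.bdry Region.B, M.intPr t (fun x => g₁ x * fn q t x) = 0 := by
    refine Finset.sum_eq_zero fun t ht => ?_
    simp only [bdry, Finset.mem_filter] at ht
    simp [hq, fn_normalJump_boundary uh ht.2.1, intPr]
  have hd : ∑ t with M.reg t = Region.B, ∫ x in M.tri t, fn q t x * ev (divV (uh t)) x = 0 := by
    refine Finset.sum_eq_zero fun t ht => ?_
    refine integral_eq_zero_of_ae ?_
    filter_upwards [hdiv t (by simpa using ht)] with x hx
    simp [hx]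
  rw [hb, hd, add_zero, add_zero] at h1
  set J : M.T → ℝ := fun t => M.intPr t fun x => fn q t x ^ 2 with hJ
  set H : M.T → ℝ := fun t => M.intPr t fun x => fn q t x * (fnV uh t x ⬝ᵥ M.nPr t) with hH
  set S : Finset M.T := Finset.univ.filter
    fun t => M.twin t ≠ t ∧ M.reg t = Region.B ∧ M.reg (M.twin t) = Region.B with hS
  have hne : ∀ t ∈ M.iface, M.twin t ≠ t := by
    intro t ht h
    simp only [iface, Finset.mem_filter] at ht
    rw [h, ht.2.1] at ht
    simp at ht
  have hsplit : ∑ t with M.reg t = Region.B, H t = ∑ t ∈ M.iface, H t + ∑ t ∈ S, H t := by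
    simp only [iface, hS, Finset.sum_filter]
    rw [← Finset.sum_add_distrib]
    refine Finset.sum_congr rfl fun t _ => ?_
    by_cases htw : M.twin t = t
    · have : H t = 0 := by simp [hH, hq, fn_normalJump_boundary uh htw, intPr]
      simp [this]
    · cases hr : M.reg t <;> cases hr' : M.reg (M.twin t) <;> simp [htw]
  have hI : ∑ t ∈ M.iface, M.intPr t (fun x => fn q t x * (fnV uh (M.twin t) x ⬝ᵥ M.nPr t))
      = ∑ t ∈ M.iface, H t - ∑ t ∈ M.iface, J t := by
    rw [← Finset.sum_sub_distrib]
    refine Finset.sum_congr rfl fun t ht => ?_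
    simp only [hH, hJ, intPr]
    rw [← segInt_sub _ _ (by fun_prop) (by fun_prop)]
    congr 1
    ext x
    rw [hq, fn_normalJump uh (hne t ht)]
    ring
  -- Interior edges occur once from each side; the two fluxes add up to `q` times the normal jump,
  -- that is, to `q²`.
  have hT : 2 * ∑ t ∈ S, H t = ∑ t ∈ S, J t := by
    rw [two_mul_sum_twin S fun t ht => by
      simp only [hS, Finset.mem_filter, Finset.mem_univ, true_and] at ht ⊢
      exact ⟨twin_twin_ne ht.1, ht.2.2, by rw [M.twin_twin]; exact ht.2.1⟩]
    refine Finset.sum_congr rfl fun t ht => ?_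
    simp only [hS, Finset.mem_filter] at ht
    have htw := ht.2.1
    simp only [hH, hJ]
    rw [intPr_twin htw, nPr_twin htw, intPr, intPr, intPr,
      ← segInt_add _ _ (by fun_prop) (by fun_prop)]
    congr 1
    ext x
    rw [hq, fn_normalJump_twin _ htw, fn_normalJump _ htw, dotProduct_neg]
    ring
  have hJ0 : ∀ t, 0 ≤ J t := fun t => segInt_nonneg _ _ fun _ => sq_nonneg _
  have hs1 := Finset.sum_nonneg fun t (_ : t ∈ M.iface) => hJ0 t
  have hs2 := Finset.sum_nonneg fun t (_ : t ∈ S) => hJ0 t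
  -- The equation has become `-∑ J - ½ ∑ J = 0`, over the interface and over the interior edges of
  -- `Ω_B` respectively, with nonnegative terms.
  have hz1 : ∑ t ∈ M.iface, J t = 0 := by linarith
  have hz2 : ∑ t ∈ S, J t = 0 := by linarith
  rw [Finset.sum_eq_zero_iff_of_nonneg fun t _ => hJ0 t] at hz1 hz2
  have key : ∀ t, M.twin t ≠ t → J t = 0 → ∀ s ∈ Set.Icc (0 : ℝ) 1,
      fnV uh (M.twin t) (M.ptPr t s) ⬝ᵥ M.nPr t = fnV uh t (M.ptPr t s) ⬝ᵥ M.nPr t := by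
    intro t htw h0 s hs
    have := eq_zero_of_segInt_sq_eq_zero (a_ne_b t) (continuous_fn q t) h0 s hs
    rw [hq, fn_normalJump uh htw] at this
    rw [ptPr]
    linarith
  intro t s hs
  by_cases htw : M.twin t = t
  · rw [htw]
  cases hr : M.reg t <;> cases hr' : M.reg (M.twin t)
  · exact key t htw (hz2 t (by simp [hS, htw, hr, hr'])) s hs
  · exact key t htw (hz1 t (by simp [iface, hr, hr'])) s hs
  -- Interface edges are indexed by their triangle in `Ω_B`, so from `Ω_D` the statement is read off
  -- the twin.
  · have := key (M.twin t) (twin_twin_ne htw)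
      (hz1 _ (by simp [iface, hr, hr', M.twin_twin])) (1 - s)
      ⟨by linarith [hs.2], by linarith [hs.1]⟩
    rw [M.twin_twin, ptPr_twin htw, nPr_twin htw, dotProduct_neg, dotProduct_neg] at this
    linarith
  · exact huD.normal_continuous htw hr hr' hs

end Mesh

/-! ### Integral inequalities and boundary terms. -/

/-- A non-integrable `F` has integral `0` by convention, which the nonnegative `G` still dominates.
Young's inequality can thus be applied to products with `ĉ` or `c_in` without proving them
integrable. -/
lemma integral_le_integral_of_le_of_nonneg {α : Type*} [MeasurableSpace α] {μ : Measure α}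
    {F G : α → ℝ} (hG : Integrable G μ) (h0 : 0 ≤ᵐ[μ] G) (h : F ≤ᵐ[μ] G) :
    ∫ x, F x ∂μ ≤ ∫ x, G x ∂μ := by
  by_cases hF : Integrable F μ
  · exact integral_mono_ae hF hG h
  · rw [integral_undef hF]
    exact integral_nonneg_of_ae h0

lemma integrable_ite {α : Type*} [MeasurableSpace α] {μ : Measure α} {F : α → ℝ} {p : α → Prop}
    [DecidablePred p] (hF : Integrable F μ) (hp : NullMeasurableSet {x | p x} μ) :
    Integrable (fun x => if p x then F x else 0) μ := by
  have : (fun x => if p x then F x else 0) = Set.indicator {x | p x} F := by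
    ext x
    simp [Set.indicator_apply]
  rw [this]
  exact hF.indicator₀ hp

/-- The boundary terms of the transport scheme add up to the weighted norm of the trace. -/
lemma boundary_identity {α : Type*} [MeasurableSpace α] {μ : Measure α} {w v c : α → ℝ}
    (hw : AEMeasurable w μ) (hF : Integrable (fun x => v x * c x * c x) μ)
    (hG : Integrable (fun x => w x * c x * c x) μ) :
    (∫ x, (if 0 ≤ w x then v x * c x * c x else 0) ∂μ)
      + 1 / 2 * (∫ x, (if 0 ≤ w x then (w x - v x) * c x * c x else 0) ∂μ)
      - 1 / 2 * (∫ x, (if w x < 0 then (w x - v x) * c x * c x else 0) ∂μ)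
      - 1 / 2 * (∫ x, c x ^ 2 * v x ∂μ) = 1 / 2 * ∫ x, |w x| * c x ^ 2 ∂μ := by
  have hp : NullMeasurableSet {x | 0 ≤ w x} μ := nullMeasurableSet_le aemeasurable_const hw
  have hn : NullMeasurableSet {x | w x < 0} μ := nullMeasurableSet_lt hw aemeasurable_const
  have hGF : Integrable (fun x => (w x - v x) * c x * c x) μ := by
    refine (hG.sub hF).congr (Filter.Eventually.of_forall fun x => ?_)
    simp only [Pi.sub_apply]
    ring
  have hF' : Integrable (fun x => c x ^ 2 * v x) μ :=
    hF.congr (Filter.Eventually.of_forall fun x => by ring)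
  have i1 := integrable_ite hF hp
  have i2 := (integrable_ite hGF hp).const_mul (1 / 2)
  have i3 := (integrable_ite hGF hn).const_mul (1 / 2)
  have i4 := hF'.const_mul (1 / 2)
  have i5 : Integrable (fun x => (if 0 ≤ w x then v x * c x * c x else 0)
      + 1 / 2 * (if 0 ≤ w x then (w x - v x) * c x * c x else 0)
      - 1 / 2 * (if w x < 0 then (w x - v x) * c x * c x else 0)) μ := (i1.add i2).sub i3
  rw [← integral_const_mul, ← integral_const_mul, ← integral_const_mul, ← integral_const_mul,
    ← integral_add i1 i2, ← integral_sub (i1.fun_add i2) i3,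
    ← integral_sub i5 i4]
  congr 1
  ext x
  -- The factor of `c²` is `v + ½(w - v) - ½v = ½w` on the outflow part and `-½(w - v) - ½v = -½w`
  -- on the inflow part; `v` cancels in both.
  rcases le_or_gt 0 (w x) with h | h
  · simp only [h, if_true, not_lt.2 h, if_false, abs_of_nonneg h]
    ring
  · simp only [h, if_true, not_le.2 h, if_false, abs_of_neg h]
    ring

/-! ### Energy estimate for one time step. -/

namespace Mesh

variable {M : Mesh}

lemma intAll_nonneg {F : M.T → Pt → ℝ}
    (h : ∀ t, 0 ≤ᵐ[volume.restrict (M.tri t)] F t) : 0 ≤ M.intAll F :=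
  Finset.sum_nonneg fun t _ => integral_nonneg_of_ae (h t)

lemma intAll_le {F G : M.T → Pt → ℝ} (hG : ∀ t, IntegrableOn (G t) (M.tri t))
    (h0 : ∀ t, 0 ≤ᵐ[volume.restrict (M.tri t)] G t)
    (h : ∀ t, F t ≤ᵐ[volume.restrict (M.tri t)] G t) : M.intAll F ≤ M.intAll G :=
  Finset.sum_le_sum fun t _ => integral_le_integral_of_le_of_nonneg (hG t) (h0 t) (h t)

lemma intAll_add {F G : M.T → Pt → ℝ} (hF : ∀ t, IntegrableOn (F t) (M.tri t))
    (hG : ∀ t, IntegrableOn (G t) (M.tri t)) :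
    M.intAll (fun t x => F t x + G t x) = M.intAll F + M.intAll G := by
  simp only [intAll]
  rw [← Finset.sum_add_distrib]
  exact Finset.sum_congr rfl fun t _ => integral_add (hF t) (hG t)

lemma intAll_const_mul (r : ℝ) (F : M.T → Pt → ℝ) :
    M.intAll (fun t x => r * F t x) = r * M.intAll F := by
  simp only [intAll]
  rw [Finset.mul_sum]
  exact Finset.sum_congr rfl fun t _ => integral_const_mul _ _

lemma intAll_congr {F G : M.T → Pt → ℝ} (h : ∀ t, F t =ᵐ[volume.restrict (M.tri t)] G t) :
    M.intAll F = M.intAll G :=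
  Finset.sum_congr rfl fun t _ => integral_congr_ae (h t)

lemma energyK_nonneg {K : Pt → Matrix (Fin 2) (Fin 2) ℝ} (hK : ∀ t, IsSPDOn (M.tri t) K)
    (z : M.VecF) : 0 ≤ energyK K z := by
  refine intAll_nonneg fun t => ?_
  filter_upwards [(hK t).1] with x hx
  have := hx.inv.posSemidef.dotProduct_mulVec_nonneg (fnV z t x)
  rw [dotProduct_comm]
  simpa using this

section Porosity

variable {φ : Pt → ℝ} {Φ : ℝ}

lemma integrableOn_weight_mul (hφm : ∀ t, AEStronglyMeasurable φ (volume.restrict (M.tri t)))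
    (hφ : ∀ t, ∀ᵐ x ∂volume.restrict (M.tri t), 0 ≤ φ x ∧ φ x ≤ Φ) {t : M.T} {F : Pt → ℝ}
    (hF : IntegrableOn F (M.tri t)) : IntegrableOn (fun x => φ x * F x) (M.tri t) := by
  refine Integrable.bdd_mul (c := Φ) hF (hφm t) ?_
  filter_upwards [hφ t] with x hx
  rw [Real.norm_eq_abs, abs_of_nonneg hx.1]
  exact hx.2

/-- From `2a(a - b) = a² - b² + (a - b)²`. The square of the increment is kept, to pay for part of
the source. -/
lemma time_derivative_identity
    (hφm : ∀ t, AEStronglyMeasurable φ (volume.restrict (M.tri t)))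
    (hφ : ∀ t, ∀ᵐ x ∂volume.restrict (M.tri t), 0 ≤ φ x ∧ φ x ≤ Φ) {Δt : ℝ} (hΔ : 0 < Δt)
    (c d : M.Sca) :
    2 * Δt * (M.intAll fun t x => φ x * ((fn c t x - fn d t x) / Δt) * fn c t x)
      + M.intAll (fun t x => φ x * fn d t x ^ 2) =
      M.intAll (fun t x => φ x * fn c t x ^ 2)
      + M.intAll (fun t x => φ x * (fn c t x - fn d t x) ^ 2) := by
  have hi : ∀ t {F : Pt → ℝ}, Continuous F → IntegrableOn (fun x => φ x * F x) (M.tri t) :=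
    fun t F hF => integrableOn_weight_mul hφm hφ (integrableOn_tri hF t)
  rw [← intAll_const_mul, ← intAll_add _ (fun t => hi t (by fun_prop)),
    ← intAll_add (fun t => hi t (by fun_prop)) (fun t => hi t (by fun_prop))]
  · refine intAll_congr fun t => Filter.Eventually.of_forall fun x => ?_
    field_simp
    ring
  · intro t
    have := hi t (F := fun x => 2 * Δt * (((fn c t x - fn d t x) / Δt) * fn c t x)) (by fun_prop)
    exact this.congr (Filter.Eventually.of_forall fun x => by ring)

/-- Young's inequality after splitting `c = d + (c - d)`: the weight `Δt/T` falls on the old value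
`d`, and the increment appears with exactly the coefficient available from
`time_derivative_identity`. -/
lemma source_le (hφm : ∀ t, AEStronglyMeasurable φ (volume.restrict (M.tri t)))
    (hφ : ∀ t, ∀ᵐ x ∂volume.restrict (M.tri t), 0 ≤ φ x ∧ φ x ≤ Φ) {Δt T : ℝ} (hΔ : 0 < Δt)
    (hT : 0 < T) {s : Pt → ℝ} (hs : ∀ t, MemLp s 2 (volume.restrict (M.tri t))) (c d : M.Sca) :
    2 * Δt * (M.intAll fun t x => φ x * s x * fn c t x) ≤
      (Δt * T + Δt ^ 2) * (M.intAll fun _ x => φ x * s x ^ 2)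
      + Δt / T * (M.intAll fun t x => φ x * fn d t x ^ 2)
      + M.intAll (fun t x => φ x * (fn c t x - fn d t x) ^ 2) := by
  have hi : ∀ t {F : Pt → ℝ}, Continuous F → IntegrableOn (fun x => φ x * F x) (M.tri t) :=
    fun t F hF => integrableOn_weight_mul hφm hφ (integrableOn_tri hF t)
  have hs2 : ∀ t, IntegrableOn (fun x => φ x * s x ^ 2) (M.tri t) := fun t =>
    integrableOn_weight_mul hφm hφ (hs t).integrable_sq
  have j1 : ∀ t, IntegrableOn (fun x => (Δt * T + Δt ^ 2) * (φ x * s x ^ 2)) (M.tri t) :=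
    fun t => (hs2 t).const_mul _
  have j2 : ∀ t, IntegrableOn (fun x => Δt / T * (φ x * fn d t x ^ 2)) (M.tri t) :=
    fun t => (hi t (F := fun x => fn d t x ^ 2) (by fun_prop)).const_mul _
  have j3 : ∀ t, IntegrableOn (fun x => φ x * (fn c t x - fn d t x) ^ 2) (M.tri t) :=
    fun t => hi t (by fun_prop)
  rw [← intAll_const_mul, ← intAll_const_mul, ← intAll_const_mul, ← intAll_add j1 j2,
    ← intAll_add (fun t => (j1 t).fun_add (j2 t)) j3]
  refine intAll_le (fun t => ((j1 t).fun_add (j2 t)).add (j3 t)) (fun t => ?_) (fun t => ?_)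
  · filter_upwards [hφ t] with x hx
    have := hx.1
    simp only [Pi.zero_apply]
    positivity
  · filter_upwards [hφ t] with x hx
    have e : (Δt * T + Δt ^ 2) * (φ x * s x ^ 2) + Δt / T * (φ x * fn d t x ^ 2)
        + φ x * (fn c t x - fn d t x) ^ 2 - 2 * Δt * (φ x * s x * fn c t x)
        = φ x * (Δt / T * (T * s x - fn d t x) ^ 2
          + (Δt * s x - (fn c t x - fn d t x)) ^ 2) := by
      field_simp
      ring
    have h0 : 0 ≤ φ x * (Δt / T * (T * s x - fn d t x) ^ 2
          + (Δt * s x - (fn c t x - fn d t x)) ^ 2) := by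
      have := hx.1
      positivity
    linarith

end Porosity

/-- The sources that inject fluid. -/
lemma injection_le {f : M.Sca} (hfB : ∀ t, M.reg t = Region.B → f t = 0) {cHat : Pt → ℝ}
    (hc : ∀ t, M.reg t = Region.D →
      IntegrableOn (fun x => cHat x ^ 2 * max (fn f t x) 0) (M.tri t)) (c : M.Sca) :
    2 * (M.intAll fun t x => cHat x * max (fn f t x) 0 * fn c t x) ≤
      (M.intReg Region.D fun t x => cHat x ^ 2 * max (fn f t x) 0)
      + M.intAll fun t x => max (fn f t x) 0 * fn c t x ^ 2 := by
  rw [intReg, Finset.sum_filter, intAll, intAll, Finset.mul_sum, ← Finset.sum_add_distrib]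
  refine Finset.sum_le_sum fun t _ => ?_
  cases hr : M.reg t
  · have : ∀ x, fn f t x = 0 := fun x => by simp [fn, hfB t hr]
    simp [this]
  · rw [if_pos rfl, ← integral_const_mul, ← integral_add (hc t hr)
      (integrableOn_tri (by fun_prop) t)]
    refine integral_le_integral_of_le_of_nonneg
      ((hc t hr).add (integrableOn_tri (by fun_prop) t)) ?_ ?_
    · filter_upwards with x
      simp only [Pi.zero_apply]
      positivity
    · filter_upwards with x
      have h0 : 0 ≤ max (fn f t x) 0 * (cHat x - fn c t x) ^ 2 := by positivity
      linarith

section Boundary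

variable {u : Pt → Vec}

/-- The trace norm weighted with the normal velocity. -/
noncomputable def boundaryNorm (u : Pt → Vec) (c : M.Sca) : ℝ :=
  ∑ t with M.twin t = t, M.intPr t fun x => |u x ⬝ᵥ M.nPr t| * fn c t x ^ 2

lemma intPr_eq_setIntegral (t : M.T) (F : Pt → ℝ) :
    M.intPr t F = dist (M.a t) (M.b t) * ∫ σ in Set.Icc (0 : ℝ) 1, F (M.ptPr t σ) := by
  rw [integral_Icc_eq_integral_Ioc, ← intervalIntegral.integral_of_le zero_le_one]
  rfl

lemma integrableOn_flux_mul {t : M.T}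
    (hu : IntegrableOn (fun σ => u (M.ptPr t σ) ⬝ᵥ M.nPr t) (Set.Icc 0 1)) {F : Pt → ℝ}
    (hF : Continuous F) :
    IntegrableOn (fun σ => u (M.ptPr t σ) ⬝ᵥ M.nPr t * F (M.ptPr t σ)) (Set.Icc 0 1) :=
  hu.mul_continuousOn (hF.comp (continuous_segPt _ _)).continuousOn isCompact_Icc

/-- The last term on the left is what convection leaves on `∂Ω`. Edge by edge this is
`boundary_identity` with `w = u · n` and `v = u_h · n`. -/
lemma sum_boundary_eq (hu : ∀ t, M.twin t = t →
      IntegrableOn (fun σ => u (M.ptPr t σ) ⬝ᵥ M.nPr t) (Set.Icc 0 1)) (uh : M.VecF) (c : M.Sca) :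
    (intOut u fun t x => (fnV uh t x ⬝ᵥ M.nPr t) * fn c t x * fn c t x)
      + 1 / 2 * (intOut u fun t x => ((u x - fnV uh t x) ⬝ᵥ M.nPr t) * fn c t x * fn c t x)
      - 1 / 2 * (intIn u fun t x => ((u x - fnV uh t x) ⬝ᵥ M.nPr t) * fn c t x * fn c t x)
      - 1 / 2 * (∑ t with M.twin t = t,
        M.intPr t fun x => fn c t x ^ 2 * (fnV uh t x ⬝ᵥ M.nPr t))
      = 1 / 2 * boundaryNorm u c := by
  simp only [intOut, intIn, boundaryNorm, Finset.mul_sum]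
  rw [← Finset.sum_add_distrib, ← Finset.sum_sub_distrib, ← Finset.sum_sub_distrib]
  refine Finset.sum_congr rfl fun t ht => ?_
  have ht' := hu t (by simpa using ht)
  have hF : IntegrableOn (fun σ => fnV uh t (M.ptPr t σ) ⬝ᵥ M.nPr t * fn c t (M.ptPr t σ)
      * fn c t (M.ptPr t σ)) (Set.Icc (0 : ℝ) 1) := by
    have : Continuous fun x => fnV uh t x ⬝ᵥ M.nPr t * fn c t x * fn c t x := by fun_prop
    exact (this.comp (continuous_segPt _ _)).continuousOn.integrableOn_compact isCompact_Icc
  have hG : IntegrableOn (fun σ => u (M.ptPr t σ) ⬝ᵥ M.nPr t * fn c t (M.ptPr t σ)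
      * fn c t (M.ptPr t σ)) (Set.Icc (0 : ℝ) 1) := by
    have := integrableOn_flux_mul ht' (F := fun x => fn c t x * fn c t x) (by fun_prop)
    exact this.congr (Filter.Eventually.of_forall fun x => by ring)
  have := boundary_identity ht'.aemeasurable hF hG
  simp only [intPr_eq_setIntegral, sub_dotProduct]
  linear_combination dist (M.a t) (M.b t) * this

/-- On the inflow part `-u · n = |u · n|`, and `|u · n| (c_in - c)² ≥ 0`. -/
lemma inflow_le {cIn : Pt → ℝ} (hu : ∀ t, M.twin t = t →
      IntegrableOn (fun σ => u (M.ptPr t σ) ⬝ᵥ M.nPr t) (Set.Icc 0 1))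
    (hc : ∀ t, M.twin t = t → IntegrableOn (fun σ => if u (M.ptPr t σ) ⬝ᵥ M.nPr t < 0
        then |u (M.ptPr t σ) ⬝ᵥ M.nPr t| * cIn (M.ptPr t σ) ^ 2 else 0) (Set.Icc 0 1))
    (c : M.Sca) :
    -(2 * intIn u fun t x => cIn x * (u x ⬝ᵥ M.nPr t) * fn c t x) ≤
      (intIn u fun t x => |u x ⬝ᵥ M.nPr t| * cIn x ^ 2) + boundaryNorm u c := by
  simp only [intIn, boundaryNorm]
  rw [Finset.mul_sum, ← Finset.sum_neg_distrib, ← Finset.sum_add_distrib]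
  refine Finset.sum_le_sum fun t ht => ?_
  have ht' : M.twin t = t := by simpa using ht
  have hi : IntegrableOn (fun σ => |u (M.ptPr t σ) ⬝ᵥ M.nPr t| * fn c t (M.ptPr t σ) ^ 2)
      (Set.Icc (0 : ℝ) 1) := by
    have := (integrableOn_flux_mul (hu t ht') (F := fun x => fn c t x ^ 2) (by fun_prop)).abs
    exact this.congr (Filter.Eventually.of_forall fun x => by simp [abs_mul])
  simp only [intPr_eq_setIntegral]
  have key : ∫ σ in Set.Icc (0 : ℝ) 1, (-2) * (if u (M.ptPr t σ) ⬝ᵥ M.nPr t < 0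
      then cIn (M.ptPr t σ) * (u (M.ptPr t σ) ⬝ᵥ M.nPr t) * fn c t (M.ptPr t σ) else 0) ≤
      ∫ σ in Set.Icc (0 : ℝ) 1, ((if u (M.ptPr t σ) ⬝ᵥ M.nPr t < 0
        then |u (M.ptPr t σ) ⬝ᵥ M.nPr t| * cIn (M.ptPr t σ) ^ 2 else 0)
        + |u (M.ptPr t σ) ⬝ᵥ M.nPr t| * fn c t (M.ptPr t σ) ^ 2) := by
    refine integral_le_integral_of_le_of_nonneg ((hc t ht').fun_add hi) ?_ ?_
    · filter_upwards with σ
      simp only [Pi.zero_apply]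
      split_ifs <;> positivity
    · filter_upwards with σ
      split_ifs with h
      · have h0 : 0 ≤ |u (M.ptPr t σ) ⬝ᵥ M.nPr t| *
            (cIn (M.ptPr t σ) - fn c t (M.ptPr t σ)) ^ 2 := by positivity
        rw [abs_of_neg h] at h0 ⊢
        linarith
      · simp only [mul_zero, zero_add]
        positivity
  rw [integral_const_mul, integral_add (hc t ht') hi] at key
  have := mul_le_mul_of_nonneg_left key (dist_nonneg (x := M.a t) (y := M.b t))
  linarith

end Boundary

lemma sum_primal_flux_eq {uh : M.VecF} (hn : NormalContinuous uh) {c : M.Sca}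
    (hc : SingleValued c) :
    ∑ t, M.intPr t (fun x => fn c t x ^ 2 * (fnV uh t x ⬝ᵥ M.nPr t))
      = ∑ t with M.twin t = t, M.intPr t fun x => fn c t x ^ 2 * (fnV uh t x ⬝ᵥ M.nPr t) := by
  have e : ∀ t x, fn (fun t => c t * c t) t x = fn c t x ^ 2 := by
    intro t x
    simp [fn, sq]
  have := sum_flux_eq_zero (Finset.univ.filter fun t => M.twin t ≠ t)
    (fun t ht => by
      simp only [Finset.mem_filter, Finset.mem_univ, true_and] at ht ⊢
      exact twin_twin_ne ht)
    (fun t ht => by simpa using ht) (fun t => c t * c t) uh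
    (fun t _ s hs => by rw [e, e, hc t s hs]) (fun t _ s hs => hn t s hs)
  simp only [e] at this
  rw [← Finset.sum_filter_add_sum_filter_not Finset.univ (fun t => M.twin t = t)]
  simpa using this

/-- The energy inequality for one time step. -/
lemma transport_step_energy {k : ℕ} {Δt T Φ : ℝ} (hΔ : 0 < Δt) (hT : 0 < T) {φ : Pt → ℝ}
    (hφm : ∀ t, AEStronglyMeasurable φ (volume.restrict (M.tri t)))
    (hφ : ∀ t, ∀ᵐ x ∂volume.restrict (M.tri t), 0 ≤ φ x ∧ φ x ≤ Φ)
    {f : M.Sca} (hfB : ∀ t, M.reg t = Region.B → f t = 0)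
    {u : Pt → Vec} (hu : ∀ t, M.twin t = t →
      IntegrableOn (fun σ => u (M.ptPr t σ) ⬝ᵥ M.nPr t) (Set.Icc 0 1))
    {uh : M.VecF} (hdl : ∀ t, ∀ s ∈ Set.Icc (0 : ℝ) 1,
      M.jumpDl (fnV uh) t (M.ptDl t s) ⬝ᵥ M.nDl t = 0)
    (hn : NormalContinuous uh)
    (hdiv : ∀ t, ∀ᵐ x ∂volume.restrict (M.tri t), ev (divV (uh t)) x = fn f t x)
    {K : Pt → Matrix (Fin 2) (Fin 2) ℝ} {s cHat cIn : Pt → ℝ}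
    (hs : ∀ t, MemLp s 2 (volume.restrict (M.tri t)))
    (hcHat : ∀ t, M.reg t = Region.D →
      IntegrableOn (fun x => cHat x ^ 2 * max (fn f t x) 0) (M.tri t))
    (hcIn : ∀ t, M.twin t = t → IntegrableOn (fun σ => if u (M.ptPr t σ) ⬝ᵥ M.nPr t < 0
        then |u (M.ptPr t σ) ⬝ᵥ M.nPr t| * cIn (M.ptPr t σ) ^ 2 else 0) (Set.Icc 0 1))
    {d c : M.Sca} {z : M.VecF}
    (h : IsTransportStep k Δt φ f u uh K s cHat cIn d z c) :
    2 * Δt * energyK K z + (M.intAll fun t x => φ x * fn c t x ^ 2) ≤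
      (1 + Δt / T) * (M.intAll fun t x => φ x * fn d t x ^ 2)
      + ((Δt * T + Δt ^ 2) * (M.intAll fun _ x => φ x * s x ^ 2)
      + Δt * (intIn u fun t x => |u x ⬝ᵥ M.nPr t| * cIn x ^ 2)
      + Δt * M.intReg Region.D fun t x => cHat x ^ 2 * max (fn f t x) 0) := by
  obtain ⟨hz, hc, h1, h2⟩ := h
  -- The scheme is tested with its own solution, `ψ = z` and `q = c`.
  have hE := h1 z hz
  have hE' := h2 c hc
  rw [formT_eq_formTstar hz hc] at hE'
  have a1 := time_derivative_identity hφm hφ hΔ c d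
  have a2 := source_le hφm hφ hΔ hT hs c d
  have a3 := injection_le hfB hcHat c
  have a4 := sum_boundary_eq hu uh c
  have a5 := inflow_le hu hcIn c
  have a6 := convection_identity (c := c) hdl
  have a7 := sum_primal_flux_eq hn hc.singleValued
  -- Here conservation enters: `div u_h = f = f⁺ - f⁻`.
  have a8 : ∑ t, ∫ x in M.tri t, fn c t x ^ 2 * ev (divV (uh t)) x =
      (M.intAll fun t x => max (fn f t x) 0 * fn c t x ^ 2)
      - M.intAll fun t x => fn c t x * max (-fn f t x) 0 * fn c t x := by
    simp only [intAll]
    rw [← Finset.sum_sub_distrib]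
    refine Finset.sum_congr rfl fun t _ => ?_
    rw [← integral_sub (integrableOn_tri (by fun_prop) t) (integrableOn_tri (by fun_prop) t)]
    refine integral_congr_ae ?_
    filter_upwards [hdiv t] with x hx
    rw [hx]
    rcases le_total 0 (fn f t x) with h0 | h0
    · rw [max_eq_left h0, max_eq_right (by linarith)]
      ring
    · rw [max_eq_right h0, max_eq_left (by linarith)]
      ring
  have a9 : 0 ≤ M.intAll fun t x => fn c t x * max (-fn f t x) 0 * fn c t x := by
    refine intAll_nonneg fun t => Filter.Eventually.of_forall fun x => ?_
    have : 0 ≤ max (-fn f t x) 0 * fn c t x ^ 2 := by positivity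
    simp only [Pi.zero_apply]
    linarith
  have a10 : 0 ≤ ∑ t, M.intDl t fun x => M.jumpDl (fn c) t x ^ 2 * |fnV uh t x ⬝ᵥ M.nDl t| :=
    Finset.sum_nonneg fun t _ => segInt_nonneg _ _ fun x => by positivity
  rw [energyK]
  rw [a8, a7] at a6
  generalize (M.intAll fun t x => φ x * ((fn c t x - fn d t x) / Δt) * fn c t x) = X at *
  generalize (M.intAll fun t x => φ x * s x * fn c t x) = R at *
  -- The terms `½ f⁺ c²` and `½ |u · n| c²` cancel against the Young bounds; `½ f⁻ c²` and the
  -- upwind dissipation are nonnegative and dropped.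
  have key : X + (M.intAll fun t x => ((K x)⁻¹ *ᵥ fnV z t x) ⬝ᵥ fnV z t x) ≤
      R + 1 / 2 * ((intIn u fun t x => |u x ⬝ᵥ M.nPr t| * cIn x ^ 2)
        + M.intReg Region.D fun t x => cHat x ^ 2 * max (fn f t x) 0) := by
    linarith
  have := mul_le_mul_of_nonneg_left key (by positivity : 0 ≤ 2 * Δt)
  linarith

/-- The `L²` projection does not increase the norm. -/
lemma intAll_sq_le_of_isL2Proj {k : ℕ} {c₀ : Pt → ℝ} {ch : M.Sca}
    (hc₀ : ∀ t, MemLp c₀ 2 (volume.restrict (M.tri t))) (h : IsL2Proj k c₀ ch) :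
    (M.intAll fun t x => fn ch t x ^ 2) ≤ M.intAll fun _ x => c₀ x ^ 2 := by
  have h0 := h.2 ch h.1
  have i1 : ∀ t, IntegrableOn (fun x => c₀ x ^ 2) (M.tri t) := fun t => (hc₀ t).integrable_sq
  have i2 : ∀ t, IntegrableOn (fun x => (c₀ x - fn ch t x) * fn ch t x) (M.tri t) := by
    intro t
    have : IsFiniteMeasure (volume.restrict (M.tri t)) :=
      isFiniteMeasure_restrict.2 (isCompact_tri t).measure_lt_top.ne
    have h1 : IntegrableOn (fun x => c₀ x - fn ch t x) (M.tri t) :=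
      ((hc₀ t).integrable one_le_two).sub (integrableOn_tri (by fun_prop) t)
    exact h1.mul_continuousOn (by fun_prop) (isCompact_tri t)
  -- The two integrands differ by `(c₀ - ch)²`, and the cross term integrates to zero by
  -- orthogonality.
  have h3 : M.intAll (fun t x => fn ch t x ^ 2 + 2 * ((c₀ x - fn ch t x) * fn ch t x)) ≤
      M.intAll fun _ x => c₀ x ^ 2 := by
    refine intAll_le i1 (fun t => Filter.Eventually.of_forall fun x => sq_nonneg _)
      (fun t => Filter.Eventually.of_forall fun x => ?_)
    have := sq_nonneg (c₀ x - fn ch t x)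
    simp only
    linarith
  rw [intAll_add (fun t => integrableOn_tri (by fun_prop) t) (fun t => (i2 t).const_mul 2),
    intAll_const_mul, h0] at h3
  linarith

end Mesh

/-- A discrete Gronwall inequality. -/
lemma discrete_gronwall {δ : ℝ} (hδ : 0 ≤ δ) {a e b : ℕ → ℝ} {N : ℕ} (he : ∀ n ≤ N, 0 ≤ e n)
    (hb : ∀ n ≤ N, 0 ≤ b n) (h : ∀ n ≤ N, e n + a (n + 1) ≤ (1 + δ) * a n + b n) :
    ∀ m ≤ N + 1, ∑ n ∈ Finset.range m, e n + a m ≤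
      (1 + δ) ^ m * (a 0 + ∑ n ∈ Finset.range m, b n) := by
  intro m
  induction m with
  | zero => intro _; simp
  | succ m ih =>
    intro hm
    have hm' : m ≤ N := by omega
    have h1 := ih (by omega)
    have h2 := h m hm'
    have h3 : 0 ≤ ∑ n ∈ Finset.range m, e n :=
      Finset.sum_nonneg fun n hn => he n (by have := Finset.mem_range.1 hn; omega)
    -- The new datum and the accumulated `e` do not carry the factor `1 + δ`; being nonnegative,
    -- they may be enlarged by it.
    have h4 : b m ≤ (1 + δ) ^ (m + 1) * b m :=
      le_mul_of_one_le_left (hb m hm') (one_le_pow₀ (by linarith))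
    rw [Finset.sum_range_succ, Finset.sum_range_succ, ← add_assoc (a 0), mul_add, pow_succ']
    rw [pow_succ'] at h4
    have h5 := mul_le_mul_of_nonneg_left h1 (by linarith : 0 ≤ 1 + δ)
    have h6 := mul_nonneg hδ h3
    linarith

end BrinkmanDarcy

/-! ### Assembly of the stability estimate. -/

theorem mainTheorem6 (T φlow φup : ℝ) (hT : 0 < T) (hφlow : 0 < φlow) (hφup : φlow ≤ φup) :
    ∃ C : ℝ, 0 < C ∧
    -- mesh, polynomial degree, number of time steps
    ∀ (M : BrinkmanDarcy.Mesh) (k N : ℕ), 1 ≤ k → 1 ≤ N →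
    -- data of the flow problem
    ∀ (ε : ℝ) (α : Matrix (Fin 2) (Fin 2) ℝ)
      (KD : BrinkmanDarcy.Pt → Matrix (Fin 2) (Fin 2) ℝ)
      (fB fD : BrinkmanDarcy.Pt → BrinkmanDarcy.Vec) (f : M.Sca)
      (g₁ g₂ : BrinkmanDarcy.Pt → ℝ),
    0 < ε → α.PosDef →
    (∀ t, M.reg t = BrinkmanDarcy.Region.D → BrinkmanDarcy.Mesh.IsSPDOn (M.tri t) KD) →
    (∀ t, M.reg t = BrinkmanDarcy.Region.B → MemLp fB 2 (volume.restrict (M.tri t))) →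
    (∀ t, M.reg t = BrinkmanDarcy.Region.D → MemLp fD 2 (volume.restrict (M.tri t))) →
    BrinkmanDarcy.Mesh.IsQD k f → (∀ t, M.reg t = BrinkmanDarcy.Region.B → f t = 0) →
    (∀ t ∈ M.bdry BrinkmanDarcy.Region.B,
      MemLp (fun σ => g₁ (M.ptPr t σ)) 2 (volume.restrict (Set.Icc (0 : ℝ) 1))) →
    (∀ t ∈ M.bdry BrinkmanDarcy.Region.D,
      MemLp (fun σ => g₂ (M.ptPr t σ)) 2 (volume.restrict (Set.Icc (0 : ℝ) 1))) →
    (∑ t ∈ M.bdry BrinkmanDarcy.Region.B, M.intPr t g₁)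
      + (∑ t ∈ M.bdry BrinkmanDarcy.Region.D, M.intPr t g₂)
      = M.intReg BrinkmanDarcy.Region.D (BrinkmanDarcy.Mesh.fn f) →
    -- the velocity enters the transport scheme only through its boundary values, whose normal
    -- component is prescribed; in particular `u` may be the exact Brinkman-Darcy velocity
    ∀ u : BrinkmanDarcy.Pt → BrinkmanDarcy.Vec,
    (∀ t ∈ M.bdry BrinkmanDarcy.Region.B, ∀ᵐ σ ∂(volume.restrict (Set.Icc (0 : ℝ) 1)),
      u (M.ptPr t σ) ⬝ᵥ M.nPr t = g₁ (M.ptPr t σ)) →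
    (∀ t ∈ M.bdry BrinkmanDarcy.Region.D, ∀ᵐ σ ∂(volume.restrict (Set.Icc (0 : ℝ) 1)),
      u (M.ptPr t σ) ⬝ᵥ M.nPr t = g₂ (M.ptPr t σ)) →
    -- the discrete flow
    ∀ (L : M.MatF) (uh : M.VecF) (pB pD : M.Sca),
    BrinkmanDarcy.Mesh.IsFlowSolution k ε α KD fB fD f g₁ g₂ L uh pB pD →
    -- data of the transport problem
    ∀ (φ : BrinkmanDarcy.Pt → ℝ) (K : ℝ → BrinkmanDarcy.Pt → Matrix (Fin 2) (Fin 2) ℝ)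
      (s cHat cIn : ℝ → BrinkmanDarcy.Pt → ℝ) (c₀ : BrinkmanDarcy.Pt → ℝ) (Δt : ℝ),
    Δt = T / N →
    (∀ t, AEStronglyMeasurable φ (volume.restrict (M.tri t))) →
    (∀ t, M.reg t = BrinkmanDarcy.Region.B → ∀ᵐ x ∂(volume.restrict (M.tri t)), φ x = 1) →
    (∀ t, M.reg t = BrinkmanDarcy.Region.D →
      ∀ᵐ x ∂(volume.restrict (M.tri t)), φlow ≤ φ x ∧ φ x ≤ φup) →
    (∀ t, ∀ n ≤ N, BrinkmanDarcy.Mesh.IsSPDOn (M.tri t) (K ((n + 1) * Δt))) →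
    (∀ t, ∀ n ≤ N, MemLp (s ((n + 1) * Δt)) 2 (volume.restrict (M.tri t))) →
    (∀ t, M.reg t = BrinkmanDarcy.Region.D → ∀ n ≤ N,
      AEStronglyMeasurable (cHat ((n + 1) * Δt)) (volume.restrict (M.tri t)) ∧
      IntegrableOn (fun x => cHat ((n + 1) * Δt) x ^ 2 * max (BrinkmanDarcy.Mesh.fn f t x) 0)
        (M.tri t)) →
    (∀ t, M.twin t = t → ∀ n ≤ N,
      AEStronglyMeasurable (fun σ => if u (M.ptPr t σ) ⬝ᵥ M.nPr t < 0
        then cIn ((n + 1) * Δt) (M.ptPr t σ) else 0) (volume.restrict (Set.Icc (0 : ℝ) 1)) ∧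
      IntegrableOn (fun σ => if u (M.ptPr t σ) ⬝ᵥ M.nPr t < 0
        then |u (M.ptPr t σ) ⬝ᵥ M.nPr t| * cIn ((n + 1) * Δt) (M.ptPr t σ) ^ 2 else 0)
        (Set.Icc (0 : ℝ) 1)) →
    (∀ t, MemLp c₀ 2 (volume.restrict (M.tri t))) →
    -- the fully discrete solution
    ∀ (z : ℕ → M.VecF) (c : ℕ → M.Sca),
    BrinkmanDarcy.Mesh.IsL2Proj k c₀ (c 0) →
    (∀ n ≤ N, BrinkmanDarcy.Mesh.IsTransportStep k Δt φ f u uh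
      (K ((n + 1) * Δt)) (s ((n + 1) * Δt)) (cHat ((n + 1) * Δt)) (cIn ((n + 1) * Δt))
      (c n) (z (n + 1)) (c (n + 1))) →
    2 * Δt * (∑ n ∈ Finset.range (N + 1),
        BrinkmanDarcy.Mesh.energyK (K ((n + 1) * Δt)) (z (n + 1)))
      + (M.intAll fun t x => φ x * BrinkmanDarcy.Mesh.fn (c (N + 1)) t x ^ 2)
    ≤ C * ((∑ n ∈ Finset.range (N + 1), Δt * M.intAll fun _ x => φ x * s ((n + 1) * Δt) x ^ 2)
      + (∑ n ∈ Finset.range (N + 1), Δt * BrinkmanDarcy.Mesh.intIn u fun t x =>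
          |u x ⬝ᵥ M.nPr t| * cIn ((n + 1) * Δt) x ^ 2)
      + (∑ n ∈ Finset.range (N + 1), Δt * M.intReg BrinkmanDarcy.Region.D fun t x =>
          cHat ((n + 1) * Δt) x ^ 2 * max (BrinkmanDarcy.Mesh.fn f t x) 0)
      + φup * M.intAll fun _ x => c₀ x ^ 2) := by
  have hφup0 : 0 < φup := hφlow.trans_le hφup
  -- A bound for the porosity on both regions: it equals `1` on `Ω_B`, and `φup` may be smaller than
  -- `1`.
  set Φ : ℝ := max 1 φup with hΦ
  -- `exp 2` is the Gronwall factor, `2 * T` comes from `Δt T + Δt² ≤ 2 T Δt`, `1` serves the inflow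
  -- and injection data, and `Φ / φup` converts the bound of the initial energy to the weight `φup`.
  refine ⟨Real.exp 2 * (2 * T + 1 + Φ / φup), by positivity, ?_⟩
  intro M k N hk hN ε α KD fB fD f g₁ g₂ _ _ _ _ _ hf hfB hg₁ hg₂ hcompat u hu₁ hu₂ L uh pB pD
    hflow φ K s cHat cIn c₀ Δt hΔt hφm hφB hφD hK hs hcHat hcIn hc₀ z c hproj hstep
  have hN0 : (0 : ℝ) < N := by exact_mod_cast hN
  have hΔ : 0 < Δt := by rw [hΔt]; positivity
  have hΔT : Δt ≤ T := by
    rw [hΔt, div_le_iff₀ hN0]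
    have : (1 : ℝ) ≤ N := by exact_mod_cast hN
    nlinarith
  obtain ⟨_, huB, _, huDg, _, _, _, hmass⟩ := id hflow
  -- the discrete velocity
  have hdivD : ∀ t, M.reg t = .D → ∀ᵐ x ∂volume.restrict (M.tri t),
      BrinkmanDarcy.ev (BrinkmanDarcy.divV (uh t)) x = BrinkmanDarcy.Mesh.fn f t x := fun t ht =>
    BrinkmanDarcy.Mesh.ae_div_eq_of_D hf huDg.1
      (fun q hq => BrinkmanDarcy.Mesh.formA_eq_of_mass hflow hq) ht
  have hQB : ∀ q : M.Sca, BrinkmanDarcy.Mesh.IsQB k q → _ := fun q hq =>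
    BrinkmanDarcy.Mesh.continuity_eq_of_isQB hg₁
      (BrinkmanDarcy.Mesh.sum_iface_flux huDg hg₂ hcompat hdivD) hmass hq
  have hdivB := fun t ht => BrinkmanDarcy.Mesh.ae_div_eq_zero_of_B (t := t) hk huB hQB ht
  have hn := BrinkmanDarcy.Mesh.normalContinuous_of_flow huB huDg.1 hdivB hQB
  have hdiv : ∀ t, ∀ᵐ x ∂volume.restrict (M.tri t),
      BrinkmanDarcy.ev (BrinkmanDarcy.divV (uh t)) x = BrinkmanDarcy.Mesh.fn f t x := by
    intro t
    cases hr : M.reg t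
    · filter_upwards [hdivB t hr] with x hx
      simp [hx, BrinkmanDarcy.Mesh.fn, hfB t hr]
    · exact hdivD t hr
  have hdl : ∀ t, ∀ σ ∈ Set.Icc (0 : ℝ) 1,
      M.jumpDl (BrinkmanDarcy.Mesh.fnV uh) t (M.ptDl t σ) ⬝ᵥ M.nDl t = 0 := by
    intro t
    cases hr : M.reg t
    · exact (huB t hr).2
    · exact (huDg.1.1 t hr).2
  have hu : ∀ t, M.twin t = t →
      IntegrableOn (fun σ => u (M.ptPr t σ) ⬝ᵥ M.nPr t) (Set.Icc 0 1) := by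
    intro t ht
    cases hr : M.reg t
    · have hb : t ∈ M.bdry .B := by simp [BrinkmanDarcy.Mesh.bdry, ht, hr]
      have hi : IntegrableOn (fun σ => g₁ (M.ptPr t σ)) (Set.Icc (0 : ℝ) 1) :=
        (hg₁ t hb).integrable one_le_two
      exact hi.congr ((hu₁ t hb).mono fun _ h => h.symm)
    · have hb : t ∈ M.bdry .D := by simp [BrinkmanDarcy.Mesh.bdry, ht, hr]
      have hi : IntegrableOn (fun σ => g₂ (M.ptPr t σ)) (Set.Icc (0 : ℝ) 1) :=
        (hg₂ t hb).integrable one_le_two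
      exact hi.congr ((hu₂ t hb).mono fun _ h => h.symm)
  -- the porosity
  have hφ : ∀ t, ∀ᵐ x ∂volume.restrict (M.tri t), 0 ≤ φ x ∧ φ x ≤ Φ := by
    intro t
    cases hr : M.reg t
    · filter_upwards [hφB t hr] with x hx
      rw [hx]
      exact ⟨zero_le_one, le_max_left _ _⟩
    · filter_upwards [hφD t hr] with x hx
      exact ⟨hφlow.le.trans hx.1, hx.2.trans (le_max_right _ _)⟩
  -- the time steps
  set S : ℕ → ℝ := fun n => M.intAll fun _ x => φ x * s ((n + 1) * Δt) x ^ 2 with hS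
  set I : ℕ → ℝ := fun n => BrinkmanDarcy.Mesh.intIn u fun t x =>
    |u x ⬝ᵥ M.nPr t| * cIn ((n + 1) * Δt) x ^ 2 with hI
  set H : ℕ → ℝ := fun n => M.intReg .D fun t x =>
    cHat ((n + 1) * Δt) x ^ 2 * max (BrinkmanDarcy.Mesh.fn f t x) 0 with hH
  set E : ℕ → ℝ := fun n => BrinkmanDarcy.Mesh.energyK (K ((n + 1) * Δt)) (z (n + 1)) with hE
  set A : ℕ → ℝ := fun n => M.intAll fun t x => φ x * BrinkmanDarcy.Mesh.fn (c n) t x ^ 2 with hA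
  have hS0 : ∀ n, 0 ≤ S n := fun n => BrinkmanDarcy.Mesh.intAll_nonneg fun t => by
    filter_upwards [hφ t] with x hx using mul_nonneg hx.1 (sq_nonneg _)
  have hI0 : ∀ n, 0 ≤ I n := fun n => Finset.sum_nonneg fun t _ =>
    BrinkmanDarcy.segInt_nonneg _ _ fun x => by split_ifs <;> positivity
  have hH0 : ∀ n, 0 ≤ H n := fun n => Finset.sum_nonneg fun t _ =>
    integral_nonneg fun x => by positivity
  have hE0 : ∀ n ≤ N, 0 ≤ E n := fun n hn =>
    BrinkmanDarcy.Mesh.energyK_nonneg (fun t => hK t n hn) _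
  have hsteps : ∀ n ≤ N, 2 * Δt * E n + A (n + 1) ≤ (1 + Δt / T) * A n
      + ((Δt * T + Δt ^ 2) * S n + Δt * I n + Δt * H n) := fun n hnN =>
    BrinkmanDarcy.Mesh.transport_step_energy hΔ hT hφm hφ hfB hu hdl hn hdiv
      (fun t => hs t n hnN) (fun t ht => (hcHat t ht n hnN).2) (fun t ht => (hcIn t ht n hnN).2)
      (hstep n hnN)
  have hgron := BrinkmanDarcy.discrete_gronwall (δ := Δt / T) (by positivity)
    (e := fun n => 2 * Δt * E n)
    (fun n hnN => mul_nonneg (by positivity) (hE0 n hnN))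
    (fun n _ => by have := hS0 n; have := hI0 n; have := hH0 n; positivity) hsteps (N + 1) le_rfl
  -- the initial value
  have hA0 : A 0 ≤ Φ * M.intAll fun _ x => c₀ x ^ 2 := by
    refine le_trans ?_ (mul_le_mul_of_nonneg_left
      (BrinkmanDarcy.Mesh.intAll_sq_le_of_isL2Proj hc₀ hproj) (by positivity))
    rw [← BrinkmanDarcy.Mesh.intAll_const_mul]
    refine BrinkmanDarcy.Mesh.intAll_le
      (fun t => BrinkmanDarcy.Mesh.integrableOn_tri (by fun_prop) t)
      (fun t => Filter.Eventually.of_forall fun x => ?_) (fun t => ?_)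
    · simp only [Pi.zero_apply]
      positivity
    · filter_upwards [hφ t] with x hx
      exact mul_le_mul_of_nonneg_right hx.2 (sq_nonneg _)
  -- There are `N + 1` steps of length `T / N`, so the exponent is `(N + 1) / N`, at most `2`.
  have hexp : (1 + Δt / T) ^ (N + 1) ≤ Real.exp 2 := by
    have h1 : Δt / T = 1 / N := by rw [hΔt]; field_simp
    have h2 : (1 + Δt / T) ^ (N + 1) ≤ Real.exp (1 / N) ^ (N + 1) := by
      rw [h1, add_comm]
      exact pow_le_pow_left₀ (by positivity) (Real.add_one_le_exp _) _
    refine h2.trans ?_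
    rw [← Real.exp_nat_mul, Real.exp_le_exp]
    push_cast
    rw [mul_one_div, div_le_iff₀ hN0]
    have : (1 : ℝ) ≤ N := by exact_mod_cast hN
    linarith
  have hc0 : 0 ≤ M.intAll fun _ x => c₀ x ^ 2 :=
    BrinkmanDarcy.Mesh.intAll_nonneg fun t => Filter.Eventually.of_forall fun x => sq_nonneg _
  have hsS : 0 ≤ ∑ n ∈ Finset.range (N + 1), Δt * S n :=
    Finset.sum_nonneg fun n _ => mul_nonneg hΔ.le (hS0 n)
  have hsI : 0 ≤ ∑ n ∈ Finset.range (N + 1), Δt * I n :=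
    Finset.sum_nonneg fun n _ => mul_nonneg hΔ.le (hI0 n)
  have hsH : 0 ≤ ∑ n ∈ Finset.range (N + 1), Δt * H n :=
    Finset.sum_nonneg fun n _ => mul_nonneg hΔ.le (hH0 n)
  have hb : ∑ n ∈ Finset.range (N + 1), ((Δt * T + Δt ^ 2) * S n + Δt * I n + Δt * H n) ≤
      2 * T * (∑ n ∈ Finset.range (N + 1), Δt * S n) + (∑ n ∈ Finset.range (N + 1), Δt * I n)
        + ∑ n ∈ Finset.range (N + 1), Δt * H n := by
    rw [Finset.mul_sum, ← Finset.sum_add_distrib, ← Finset.sum_add_distrib]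
    refine Finset.sum_le_sum fun n _ => ?_
    have h1 := mul_nonneg (mul_nonneg hΔ.le (hS0 n)) (sub_nonneg.2 hΔT)
    linarith
  have hq : 0 ≤ Φ / φup := by positivity
  have hΦe : Φ * (M.intAll fun _ x => c₀ x ^ 2)
      = Φ / φup * (φup * M.intAll fun _ x => c₀ x ^ 2) := by field_simp
  have hB0 : 0 ≤ φup * M.intAll fun _ x => c₀ x ^ 2 := mul_nonneg hφup0.le hc0
  rw [Finset.mul_sum]
  refine hgron.trans ?_
  generalize (∑ n ∈ Finset.range (N + 1), Δt * S n) = s1 at *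
  generalize (∑ n ∈ Finset.range (N + 1), Δt * I n) = s2 at *
  generalize (∑ n ∈ Finset.range (N + 1), Δt * H n) = s3 at *
  rw [hΦe] at hA0
  generalize (φup * M.intAll fun _ x => c₀ x ^ 2) = s4 at *
  rw [mul_assoc]
  have hle : A 0 + ∑ n ∈ Finset.range (N + 1), ((Δt * T + Δt ^ 2) * S n + Δt * I n + Δt * H n) ≤
      (2 * T + 1 + Φ / φup) * (s1 + s2 + s3 + s4) := by
    have t1 := mul_nonneg hq (add_nonneg (add_nonneg hsS hsI) hsH)
    have t2 := mul_nonneg hT.le (add_nonneg (add_nonneg hsI hsH) hB0)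
    linarith
  refine (mul_le_mul_of_nonneg_left hle (by positivity)).trans
    (mul_le_mul_of_nonneg_right hexp (by positivity))
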